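/- Let $k$ be a field of characteristic zero. For a field $L$ containing $k$ and an integer $m\ge 0$, let $A_m(L)$ be the $m$-th Weyl algebra over $L$, i.e. the unital associative $L$-algebra generated by $x_1,\dots,x_m,\partial_1,\dots,\partial_m$ subject to $x_ix_j=x_jx_i$, $\partial_i\partial_j=\partial_j\partial_i$ and $\partial_ix_j-x_j\partial_i=\delta_{ij}$, and let $F_m(L)$ be its skew field of fractions. Let $n\ge 0$, let $G$ be a finite group and let $\rho\colon G\to GL_n(k)$ be a homomorphism. Let $G$ act on $A_n(k)$ by the $k$-algebra automorphisms $g\cdot x_j=\sum_i \rho(g)_{ij}x_i$, $g\cdot\partial_j=\sum_i(\rho(g)^{-1})_{ji}\,\partial_i$ (equivalently, $G$ acts linearly on $k[x_1,\dots,x_n]$ and on the differential operators on this ring by conjugation), extend this action to $F_n(k)$, and let $F_n(k)^G$ be the skew subfield of elements fixed by every $g\in G$. Theorem. If $F_n(k)^G$ is isomorphic, as a $k$-algebra, to $F_m(L)$ for some $m\ge 0$ and some purely transcendental extension $L$ of $k$ of transcendence degree $t$, then $m=n$ and $t=0$. -/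

import Mathlib

open scoped nonZeroDivisors

/-! ### The Weyl algebra by generators and relations -/

/-- Relations of the `n`-th Weyl algebra. In the free algebra on `Fin n ⊕ Fin n`, the generator
`Sum.inl i` stands for `x_i` and `Sum.inr i` for `∂_i`. -/
inductive WeylRel (k : Type*) [Field k] (n : ℕ) :
    FreeAlgebra k (Fin n ⊕ Fin n) → FreeAlgebra k (Fin n ⊕ Fin n) → Prop
  | xx (i j : Fin n) : WeylRel k n
      (FreeAlgebra.ι k (Sum.inl i) * FreeAlgebra.ι k (Sum.inl j))
      (FreeAlgebra.ι k (Sum.inl j) * FreeAlgebra.ι k (Sum.inl i))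
  | dd (i j : Fin n) : WeylRel k n
      (FreeAlgebra.ι k (Sum.inr i) * FreeAlgebra.ι k (Sum.inr j))
      (FreeAlgebra.ι k (Sum.inr j) * FreeAlgebra.ι k (Sum.inr i))
  | dx (i j : Fin n) : WeylRel k n
      (FreeAlgebra.ι k (Sum.inr i) * FreeAlgebra.ι k (Sum.inl j))
      (FreeAlgebra.ι k (Sum.inl j) * FreeAlgebra.ι k (Sum.inr i) + if i = j then 1 else 0)

/-- The `n`-th Weyl algebra `A_n(k)`: the unital associative `k`-algebra generated by
`x_1, …, x_n, ∂_1, …, ∂_n` subject to `x_i x_j = x_j x_i`, `∂_i ∂_j = ∂_j ∂_i` and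
`∂_i x_j - x_j ∂_i = δ_ij`. -/
def WeylAlgebra (k : Type*) [Field k] (n : ℕ) : Type _ := RingQuot (WeylRel k n)

namespace WeylAlgebra

noncomputable section

variable {k : Type*} [Field k] {n : ℕ}

instance : Ring (WeylAlgebra k n) := inferInstanceAs (Ring (RingQuot (WeylRel k n)))

/-- `A_n(L)` is an algebra over every commutative semiring over which `L` is an algebra,
in particular over `L` itself and over every subfield of `L`. -/
instance {R : Type*} [CommSemiring R] [Algebra R k] : Algebra R (WeylAlgebra k n) :=
  inferInstanceAs (Algebra R (RingQuot (WeylRel k n)))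

instance {R : Type*} [CommSemiring R] [Algebra R k] : IsScalarTower R k (WeylAlgebra k n) :=
  inferInstanceAs (IsScalarTower R k (RingQuot (WeylRel k n)))

variable (k n) in
/-- The quotient map from the free algebra. -/
def mk : FreeAlgebra k (Fin n ⊕ Fin n) →ₐ[k] WeylAlgebra k n := RingQuot.mkAlgHom k (WeylRel k n)

lemma mk_surjective : Function.Surjective (mk k n) := RingQuot.mkAlgHom_surjective k (WeylRel k n)

variable (k) in
/-- The generators: `gen k (Sum.inl i) = x_i` and `gen k (Sum.inr i) = ∂_i`. -/
def gen (a : Fin n ⊕ Fin n) : WeylAlgebra k n := mk k n (FreeAlgebra.ι k a)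

variable (k) in
/-- The generator `x_i`. -/
def x (i : Fin n) : WeylAlgebra k n := gen k (Sum.inl i)

variable (k) in
/-- The generator `∂_i`. -/
def d (i : Fin n) : WeylAlgebra k n := gen k (Sum.inr i)

lemma x_mul_x (i j : Fin n) : x k i * x k j = x k j * x k i := by
  have h := RingQuot.mkAlgHom_rel k (WeylRel.xx (k := k) i j)
  rw [map_mul, map_mul] at h
  exact h

lemma d_mul_d (i j : Fin n) : d k i * d k j = d k j * d k i := by
  have h := RingQuot.mkAlgHom_rel k (WeylRel.dd (k := k) i j)
  rw [map_mul, map_mul] at h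
  exact h

lemma d_mul_x (i j : Fin n) : d k i * x k j = x k j * d k i + if i = j then 1 else 0 := by
  have h := RingQuot.mkAlgHom_rel k (WeylRel.dx (k := k) i j)
  rw [map_add, map_mul, map_mul, apply_ite (RingQuot.mkAlgHom k (WeylRel k n)), map_one,
    map_zero] at h
  exact h

/-- The universal property of the Weyl algebra. -/
def lift {B : Type*} [Ring B] [Algebra k B] (X D : Fin n → B)
    (hX : ∀ i j, X i * X j = X j * X i) (hD : ∀ i j, D i * D j = D j * D i)
    (hDX : ∀ i j, D i * X j = X j * D i + if i = j then 1 else 0) : WeylAlgebra k n →ₐ[k] B :=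
  RingQuot.liftAlgHom k ⟨FreeAlgebra.lift k (Sum.elim X D), by
    intro p q h
    induction h with
    | xx i j => simpa using hX i j
    | dd i j => simpa using hD i j
    | dx i j =>
      rw [map_mul, map_add, map_mul,
        apply_ite (FreeAlgebra.lift k (Sum.elim X D)), map_one, map_zero]
      simpa using hDX i j⟩

section lift

variable {B : Type*} [Ring B] [Algebra k B] (X D : Fin n → B)
    (hX : ∀ i j, X i * X j = X j * X i) (hD : ∀ i j, D i * D j = D j * D i)
    (hDX : ∀ i j, D i * X j = X j * D i + if i = j then 1 else 0)

lemma lift_x (i : Fin n) : lift X D hX hD hDX (x k i) = X i := by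
  refine (RingQuot.liftAlgHom_mkAlgHom_apply (S := k) _ _ _).trans ?_
  simp

lemma lift_d (i : Fin n) : lift X D hX hD hDX (d k i) = D i := by
  refine (RingQuot.liftAlgHom_mkAlgHom_apply (S := k) _ _ _).trans ?_
  simp

end lift

lemma algHom_ext {B : Type*} [Ring B] [Algebra k B] {f g : WeylAlgebra k n →ₐ[k] B}
    (hx : ∀ i, f (x k i) = g (x k i)) (hd : ∀ i, f (d k i) = g (d k i)) : f = g := by
  refine RingQuot.ringQuot_ext' (S := k) f g ?_
  ext a
  rcases a with i | i
  · exact hx i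
  · exact hd i

/-! ### The Weyl algebra over a field of characteristic zero is a left Ore domain -/

instance : Nontrivial (WeylAlgebra k n) := by
  let f : WeylAlgebra k n →ₐ[k] Module.End k (MvPolynomial (Fin n) k) :=
    lift (fun i => LinearMap.mulLeft k (MvPolynomial.X i : MvPolynomial (Fin n) k))
      (fun i => (MvPolynomial.pderiv (R := k) i).toLinearMap)
      (fun i j => LinearMap.ext fun p => by simp [mul_left_comm])
      (fun i j => by
        refine LinearMap.ext fun p => ?_
        have h : ⁅MvPolynomial.pderiv (R := k) i, MvPolynomial.pderiv (R := k) j⁆ = 0 := by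
          apply MvPolynomial.derivation_ext
          intro l
          simp [Derivation.commutator_apply, MvPolynomial.pderiv_X, Pi.single_apply, apply_ite]
        have h2 := congrArg (fun D => D p) h
        simp only [Derivation.commutator_apply, Derivation.zero_apply, sub_eq_zero] at h2
        exact h2)
      (fun i j => by
        refine LinearMap.ext fun p => ?_
        by_cases hij : i = j
        · subst hij
          simp [MvPolynomial.pderiv_X]
        · simp [hij, MvPolynomial.pderiv_X, Ne.symm hij])
  exact f.toRingHom.domain_nontrivial

/-- The scalar commutators of the generators. -/
def om (a b : Fin n ⊕ Fin n) : k :=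
  match a, b with
  | Sum.inl i, Sum.inr j => if j = i then -1 else 0
  | Sum.inr i, Sum.inl j => if i = j then 1 else 0
  | _, _ => 0

lemma gen_comm (a b : Fin n ⊕ Fin n) :
    gen k a * gen k b - gen k b * gen k a = algebraMap k (WeylAlgebra k n) (om a b) := by
  rcases a with i | i <;> rcases b with j | j
  · have := x_mul_x (k := k) i j
    simp only [x] at this
    simp [this, om]
  · have := d_mul_x (k := k) j i
    simp only [x, d] at this
    rw [this]
    by_cases h : j = i <;> simp [om, h]
  · have := d_mul_x (k := k) i j
    simp only [x, d] at this
    rw [this]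
    by_cases h : i = j <;> simp [om, h]
  · have := d_mul_d (k := k) i j
    simp only [d] at this
    simp [this, om]

variable (k) in
/-- Products of generators. -/
def word (l : List (Fin n ⊕ Fin n)) : WeylAlgebra k n := (l.map (gen k)).prod

lemma word_nil : word k ([] : List (Fin n ⊕ Fin n)) = 1 := rfl

lemma word_cons (a : Fin n ⊕ Fin n) (l : List (Fin n ⊕ Fin n)) :
    word k (a :: l) = gen k a * word k l := by simp [word]

lemma word_append (l l' : List (Fin n ⊕ Fin n)) : word k (l ++ l') = word k l * word k l' := by
  simp [word]

variable (k n) in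
/-- The Bernstein filtration: the span of the words of length at most `e`. -/
def V (e : ℕ) : Submodule k (WeylAlgebra k n) :=
  Submodule.span k (word k '' {l | l.length ≤ e})

lemma word_mem {l : List (Fin n ⊕ Fin n)} {e : ℕ} (h : l.length ≤ e) : word k l ∈ V k n e :=
  Submodule.subset_span ⟨l, h, rfl⟩

lemma V_mono {e e' : ℕ} (h : e ≤ e') : V k n e ≤ V k n e' :=
  Submodule.span_mono (Set.image_mono fun _ hl => le_trans hl h)

lemma mul_mem_V {e e' : ℕ} {P Q : WeylAlgebra k n} (hP : P ∈ V k n e) (hQ : Q ∈ V k n e') :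
    P * Q ∈ V k n (e + e') := by
  have h : V k n e * V k n e' ≤ V k n (e + e') := by
    rw [V, V, Submodule.span_mul_span, Submodule.span_le]
    rintro _ ⟨_, ⟨l, hl, rfl⟩, _, ⟨l', hl', rfl⟩, rfl⟩
    simp only [Set.mem_ofPred_eq] at hl hl'
    change word k l * word k l' ∈ _
    rw [← word_append]
    exact word_mem (by simp; omega)
  exact h (Submodule.mul_mem_mul hP hQ)

lemma gen_mem (a : Fin n ⊕ Fin n) : gen k a ∈ V k n 1 := by
  have h := word_mem (k := k) (l := [a]) (e := 1) (by simp)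
  simpa [word_cons, word_nil] using h

lemma gen_mul_mem {e : ℕ} {P : WeylAlgebra k n} (a : Fin n ⊕ Fin n) (hP : P ∈ V k n e) :
    gen k a * P ∈ V k n (e + 1) := by
  rw [add_comm]
  exact mul_mem_V (gen_mem a) hP

lemma algebraMap_mem (c : k) : algebraMap k (WeylAlgebra k n) c ∈ V k n 0 := by
  rw [Algebra.algebraMap_eq_smul_one, ← word_nil]
  exact Submodule.smul_mem _ _ (word_mem (by simp))

lemma exists_algebraMap_eq {P : WeylAlgebra k n} (hP : P ∈ V k n 0) :
    ∃ c : k, algebraMap k (WeylAlgebra k n) c = P := by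
  have h : (word k '' {l : List (Fin n ⊕ Fin n) | l.length ≤ 0}) = {1} := by
    ext y
    simp [word_nil]
  rw [V, h, Submodule.mem_span_singleton] at hP
  obtain ⟨c, hc⟩ := hP
  exact ⟨c, by rw [Algebra.algebraMap_eq_smul_one, hc]⟩

lemma exists_mem_V (P : WeylAlgebra k n) : ∃ e, P ∈ V k n e := by
  obtain ⟨p, rfl⟩ := mk_surjective P
  induction p using FreeAlgebra.induction with
  | grade0 r => exact ⟨0, by rw [AlgHom.commutes]; exact algebraMap_mem r⟩
  | grade1 a => exact ⟨1, gen_mem a⟩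
  | mul a b ha hb =>
    obtain ⟨e, he⟩ := ha
    obtain ⟨e', he'⟩ := hb
    exact ⟨e + e', by rw [map_mul]; exact mul_mem_V he he'⟩
  | add a b ha hb =>
    obtain ⟨e, he⟩ := ha
    obtain ⟨e', he'⟩ := hb
    refine ⟨e + e', ?_⟩
    rw [map_add]
    exact add_mem (V_mono (by omega) he) (V_mono (by omega) he')

variable (k) in
/-- The inner derivation given by a generator. -/
def ad (a : Fin n ⊕ Fin n) : WeylAlgebra k n →ₗ[k] WeylAlgebra k n :=
  LinearMap.mulLeft k (gen k a) - LinearMap.mulRight k (gen k a)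

lemma ad_apply (a : Fin n ⊕ Fin n) (P : WeylAlgebra k n) :
    ad k a P = gen k a * P - P * gen k a := rfl

lemma ad_mul (a : Fin n ⊕ Fin n) (P Q : WeylAlgebra k n) :
    ad k a (P * Q) = ad k a P * Q + P * ad k a Q := by
  simp only [ad_apply]
  noncomm_ring

lemma ad_gen (a b : Fin n ⊕ Fin n) :
    ad k a (gen k b) = algebraMap k (WeylAlgebra k n) (om a b) := gen_comm a b

lemma ad_one (a : Fin n ⊕ Fin n) : ad k a 1 = 0 := by simp [ad_apply]

lemma ad_ad (a b : Fin n ⊕ Fin n) (P : WeylAlgebra k n) :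
    ad k a (ad k b P) = ad k b (ad k a P) := by
  have h := gen_comm (k := k) a b
  have h2 := Algebra.commutes (om a b : k) P
  rw [← h] at h2
  have h3 : ad k a (ad k b P) - ad k b (ad k a P) =
      (gen k a * gen k b - gen k b * gen k a) * P
        - P * (gen k a * gen k b - gen k b * gen k a) := by
    simp only [ad_apply]
    noncomm_ring
  rw [h2, sub_self] at h3
  exact sub_eq_zero.mp h3

lemma algebraMap_mul_mem (c : k) {e : ℕ} {P : WeylAlgebra k n} (hP : P ∈ V k n e) :
    algebraMap k (WeylAlgebra k n) c * P ∈ V k n e := by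
  rw [← Algebra.smul_def]
  exact Submodule.smul_mem _ _ hP

lemma ad_word_mem (a : Fin n ⊕ Fin n) (l : List (Fin n ⊕ Fin n)) :
    ad k a (word k l) ∈ V k n (l.length - 1) := by
  induction l with
  | nil => simp [word_nil, ad_one]
  | cons b l ih =>
    rw [word_cons, ad_mul, ad_gen]
    refine add_mem (algebraMap_mul_mem _ (word_mem (by simp))) ?_
    rcases l with _ | ⟨c, l⟩
    · simp [word_nil, ad_one]
    · exact gen_mul_mem b ih

lemma ad_mem (a : Fin n ⊕ Fin n) {e : ℕ} {P : WeylAlgebra k n} (hP : P ∈ V k n e) :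
    ad k a P ∈ V k n (e - 1) := by
  have h : V k n e ≤ (V k n (e - 1)).comap (ad k a) := by
    rw [V, Submodule.span_le]
    rintro _ ⟨l, hl, rfl⟩
    simp only [Set.mem_ofPred_eq] at hl
    exact V_mono (by omega) (ad_word_mem a l)
  exact h hP

lemma ad_eq_zero (a : Fin n ⊕ Fin n) {P : WeylAlgebra k n} (hP : P ∈ V k n 0) :
    ad k a P = 0 := by
  obtain ⟨c, rfl⟩ := exists_algebraMap_eq hP
  rw [ad_apply, ← Algebra.commutes c (gen k a), sub_self]

lemma ad_pow_eq_zero (a : Fin n ⊕ Fin n) {e : ℕ} {P : WeylAlgebra k n} (hP : P ∈ V k n e) :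
    ((ad k a) ^ (e + 1)) P = 0 := by
  induction e generalizing P with
  | zero => simpa using ad_eq_zero a hP
  | succ e ih =>
    have h := ad_mem a hP
    rw [Nat.add_sub_cancel] at h
    rw [pow_succ, Module.End.mul_apply, ih h]

variable (k n) in
/-- An Euler operator for the Bernstein filtration. -/
def euler : WeylAlgebra k n →ₗ[k] WeylAlgebra k n :=
  ∑ i : Fin n, (LinearMap.mulLeft k (x k i) ∘ₗ ad k (Sum.inr i)
    - LinearMap.mulLeft k (d k i) ∘ₗ ad k (Sum.inl i))

lemma euler_apply (P : WeylAlgebra k n) : euler k n P =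
    ∑ i : Fin n, (x k i * ad k (Sum.inr i) P - d k i * ad k (Sum.inl i) P) := by
  simp [euler]

lemma sum_om_mul_gen (b : Fin n ⊕ Fin n) :
    ∑ i : Fin n, (x k i * algebraMap k (WeylAlgebra k n) (om (Sum.inr i) b)
      - d k i * algebraMap k (WeylAlgebra k n) (om (Sum.inl i) b)) = gen k b := by
  rcases b with j | j
  · rw [Finset.sum_eq_single j]
    · simp [om, x]
    · intro i _ hij
      simp [om, hij]
    · simp
  · rw [Finset.sum_eq_single j]
    · simp [om, d]
    · intro i _ hij
      simp [om, hij.symm]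
    · simp

lemma euler_gen_mul (b : Fin n ⊕ Fin n) (P : WeylAlgebra k n) :
    euler k n (gen k b * P) = gen k b * P + gen k b * euler k n P
      + ∑ i : Fin n, (algebraMap k (WeylAlgebra k n) (om (Sum.inl i) b) * ad k (Sum.inr i) P
        - algebraMap k (WeylAlgebra k n) (om (Sum.inr i) b) * ad k (Sum.inl i) P) := by
  conv_rhs => enter [1, 1]; rw [← sum_om_mul_gen b]
  rw [euler_apply, euler_apply, Finset.sum_mul, Finset.mul_sum, ← Finset.sum_add_distrib,
    ← Finset.sum_add_distrib]
  refine Finset.sum_congr rfl fun i _ => ?_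
  rw [← gen_comm (Sum.inl i) b, ad_mul, ad_mul, ad_gen, ad_gen]
  conv_rhs => enter [2, 2]; rw [← gen_comm (Sum.inr i) b]
  rw [← gen_comm (Sum.inl i) b]
  simp only [x, d]
  noncomm_ring

lemma euler_word (l : List (Fin n ⊕ Fin n)) :
    euler k n (word k l) - (l.length : k) • word k l ∈ V k n (l.length - 1) := by
  induction l with
  | nil => simp [word_nil, euler_apply, ad_one]
  | cons b l ih =>
    have key : euler k n (word k (b :: l)) - ((b :: l).length : k) • word k (b :: l) =
        gen k b * (euler k n (word k l) - (l.length : k) • word k l)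
      + ∑ i : Fin n, (algebraMap k (WeylAlgebra k n) (om (Sum.inl i) b)
          * ad k (Sum.inr i) (word k l)
        - algebraMap k (WeylAlgebra k n) (om (Sum.inr i) b) * ad k (Sum.inl i) (word k l)) := by
      rw [word_cons, euler_gen_mul, mul_sub, mul_smul_comm]
      simp only [List.length_cons, Nat.cast_add, Nat.cast_one, add_smul, one_smul]
      abel
    rw [key]
    refine add_mem ?_ (Submodule.sum_mem _ fun i _ => sub_mem ?_ ?_)
    · rcases l with _ | ⟨c, l⟩
      · simp [word_nil, euler_apply, ad_one]
      · exact gen_mul_mem b ih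
    · exact algebraMap_mul_mem _ (V_mono (by simp) (ad_word_mem _ l))
    · exact algebraMap_mul_mem _ (V_mono (by simp) (ad_word_mem _ l))

lemma euler_sub_mem {e : ℕ} {P : WeylAlgebra k n} (hP : P ∈ V k n (e + 1)) :
    euler k n P - ((e + 1 : ℕ) : k) • P ∈ V k n e := by
  have h : V k n (e + 1) ≤
      (V k n e).comap (euler k n - ((e + 1 : ℕ) : k) • LinearMap.id) := by
    rw [V, Submodule.span_le]
    rintro _ ⟨l, hl, rfl⟩
    simp only [Set.mem_ofPred_eq] at hl
    change euler k n (word k l) - ((e + 1 : ℕ) : k) • word k l ∈ V k n e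
    have h1 := euler_word (k := k) l
    rcases Nat.lt_or_ge l.length (e + 1) with h2 | h2
    · have h3 : word k l ∈ V k n e := word_mem (by omega)
      have h4 : euler k n (word k l) ∈ V k n e := by
        have h5 := add_mem (V_mono (show l.length - 1 ≤ e by omega) h1)
          (Submodule.smul_mem _ (l.length : k) h3)
        simpa using h5
      exact sub_mem h4 (Submodule.smul_mem _ _ h3)
    · have h3 : l.length = e + 1 := le_antisymm hl h2
      rw [h3] at h1
      exact h1
  exact h hP

lemma mem_V_zero_of_central [CharZero k] {P : WeylAlgebra k n} (h : ∀ a, ad k a P = 0) :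
    P ∈ V k n 0 := by
  obtain ⟨e, he⟩ := exists_mem_V P
  induction e with
  | zero => exact he
  | succ e ih =>
    refine ih ?_
    have h1 := euler_sub_mem he
    have h2 : euler k n P = 0 := by simp [euler_apply, h]
    rw [h2, zero_sub, Submodule.neg_mem_iff] at h1
    exact (Submodule.smul_mem_iff _ (by exact_mod_cast Nat.succ_ne_zero e)).mp h1

lemma ad_pow_mul (a : Fin n ⊕ Fin n) (p q : ℕ) (P Q : WeylAlgebra k n)
    (hP : (ad k a ^ (p + 1)) P = 0) (hQ : (ad k a ^ (q + 1)) Q = 0) :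
    (ad k a ^ (p + q)) (P * Q) = (p + q).choose p • ((ad k a ^ p) P * (ad k a ^ q) Q) := by
  induction hN : p + q generalizing p q P Q with
  | zero =>
    obtain ⟨rfl, rfl⟩ : p = 0 ∧ q = 0 := by omega
    simp
  | succ N ih =>
    rw [pow_succ, Module.End.mul_apply, ad_mul, map_add]
    rcases p with _ | p <;> rcases q with _ | q
    · omega
    · have h0 : ad k a P = 0 := by simpa using hP
      rw [pow_succ, Module.End.mul_apply] at hQ
      have := ih 0 q P (ad k a Q) hP hQ (by omega)
      rw [h0, zero_mul, map_zero, zero_add, this]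
      simp [pow_succ]
    · have h0 : ad k a Q = 0 := by simpa using hQ
      rw [pow_succ, Module.End.mul_apply] at hP
      have := ih p 0 (ad k a P) Q hP hQ (by omega)
      rw [h0, mul_zero, map_zero, add_zero, this]
      obtain rfl : p = N := by omega
      simp [pow_succ]
    · have hP2 := hP
      have hQ2 := hQ
      rw [pow_succ, Module.End.mul_apply] at hP2 hQ2
      have h1 := ih p (q + 1) (ad k a P) Q hP2 hQ (by omega)
      have h2 := ih (p + 1) q P (ad k a Q) hP hQ2 (by omega)
      rw [h1, h2, Nat.choose_succ_succ, add_smul]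
      simp only [pow_succ, Module.End.mul_apply]

lemma exists_ad_pow (a : Fin n ⊕ Fin n) {P : WeylAlgebra k n} (hP : P ≠ 0) :
    ∃ p, (ad k a ^ p) P ≠ 0 ∧ (ad k a ^ (p + 1)) P = 0 := by
  classical
  obtain ⟨e, he⟩ := exists_mem_V P
  have hex : ∃ p, (ad k a ^ (p + 1)) P = 0 := ⟨e, ad_pow_eq_zero a he⟩
  refine ⟨Nat.find hex, ?_, Nat.find_spec hex⟩
  rcases h : Nat.find hex with _ | m
  · simpa using hP
  · exact Nat.find_min hex (by omega)

lemma ad_ad_pow (a b : Fin n ⊕ Fin n) (p : ℕ) {P : WeylAlgebra k n} (h : ad k b P = 0) :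
    ad k b ((ad k a ^ p) P) = 0 := by
  induction p with
  | zero => simpa using h
  | succ p ih => rw [pow_succ', Module.End.mul_apply, ad_ad, ih, map_zero]

lemma exists_central_zero_divisors [CharZero k] {P Q : WeylAlgebra k n} (hP : P ≠ 0) (hQ : Q ≠ 0)
    (hPQ : P * Q = 0) (S : Finset (Fin n ⊕ Fin n)) :
    ∃ P₁ Q₁ : WeylAlgebra k n, P₁ ≠ 0 ∧ Q₁ ≠ 0 ∧ P₁ * Q₁ = 0 ∧
      ∀ a ∈ S, ad k a P₁ = 0 ∧ ad k a Q₁ = 0 := by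
  classical
  induction S using Finset.induction_on with
  | empty => exact ⟨P, Q, hP, hQ, hPQ, by simp⟩
  | insert a S _ ih =>
    obtain ⟨P₁, Q₁, hP₁, hQ₁, hz, hS⟩ := ih
    obtain ⟨p, hp, hp2⟩ := exists_ad_pow a hP₁
    obtain ⟨q, hq, hq2⟩ := exists_ad_pow a hQ₁
    refine ⟨(ad k a ^ p) P₁, (ad k a ^ q) Q₁, hp, hq, ?_, ?_⟩
    · have h := ad_pow_mul a p q P₁ Q₁ hp2 hq2
      rw [hz, map_zero, ← Nat.cast_smul_eq_nsmul k] at h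
      refine (smul_eq_zero.mp h.symm).resolve_left ?_
      exact_mod_cast (Nat.choose_pos (Nat.le_add_right p q)).ne'
    · intro b hb
      rcases Finset.mem_insert.mp hb with rfl | hb
      · rw [pow_succ', Module.End.mul_apply] at hp2 hq2
        exact ⟨hp2, hq2⟩
      · exact ⟨ad_ad_pow a b p (hS b hb).1, ad_ad_pow a b q (hS b hb).2⟩

instance [CharZero k] : NoZeroDivisors (WeylAlgebra k n) where
  eq_zero_or_eq_zero_of_mul_eq_zero := by
    intro P Q hPQ
    by_contra! hne
    obtain ⟨P₁, Q₁, hP, hQ, hz, hS⟩ :=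
      exists_central_zero_divisors hne.1 hne.2 hPQ Finset.univ
    obtain ⟨c, rfl⟩ := exists_algebraMap_eq
      (mem_V_zero_of_central fun a => (hS a (Finset.mem_univ a)).1)
    rw [← Algebra.smul_def] at hz
    rcases smul_eq_zero.mp hz with h | h
    · exact hP (by rw [h, map_zero])
    · exact hQ h

lemma word_perm {l l' : List (Fin n ⊕ Fin n)} (h : l.Perm l') :
    word k l - word k l' ∈ V k n (l.length - 1) := by
  induction h with
  | nil => simp
  | cons a h ih =>
    rename_i l₁ l₂
    rw [word_cons, word_cons, ← mul_sub]
    rcases l₁ with _ | ⟨c, l₁⟩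
    · have := h.nil_eq
      subst this
      simp
    · exact gen_mul_mem a ih
  | swap a b l =>
    have h1 : word k (b :: a :: l) - word k (a :: b :: l) =
        algebraMap k (WeylAlgebra k n) (om b a) * word k l := by
      rw [← gen_comm]
      simp only [word_cons]
      noncomm_ring
    rw [h1]
    exact algebraMap_mul_mem _ (word_mem (by simp))
  | trans h1 h2 ih1 ih2 =>
    rw [← h1.length_eq] at ih2
    have := add_mem ih1 ih2
    simpa using this

lemma V_le_span (e : ℕ) : V k n e ≤ Submodule.span k
    (Set.range fun f : Fin n ⊕ Fin n → Fin (e + 1) =>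
      word k (∑ a, Multiset.replicate (f a : ℕ) a).toList) := by
  set W := Submodule.span k (Set.range fun f : Fin n ⊕ Fin n → Fin (e + 1) =>
      word k (∑ a, Multiset.replicate (f a : ℕ) a).toList) with hW
  have main : ∀ N, N ≤ e → V k n N ≤ W := by
    intro N
    induction N using Nat.strong_induction_on with
    | _ N ih =>
      intro hN
      rw [V, Submodule.span_le]
      rintro _ ⟨l, hl, rfl⟩
      simp only [Set.mem_ofPred_eq] at hl
      have hc : ∀ a, (l : Multiset (Fin n ⊕ Fin n)).count a < e + 1 := fun a =>
        Nat.lt_succ_of_le ((Multiset.count_le_card _ _).trans (hl.trans hN))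
      have hm : (∑ a, Multiset.replicate ((l : Multiset (Fin n ⊕ Fin n)).count a) a) =
           (l : Multiset (Fin n ⊕ Fin n)) := by
        ext b
        rw [Multiset.count_sum', Finset.sum_eq_single b]
        · simp
        · intro a _ hab
          simp [Multiset.count_replicate, hab]
        · simp
      have hw : word k (l : Multiset (Fin n ⊕ Fin n)).toList ∈ W := by
        rw [← hm]
        exact Submodule.subset_span ⟨fun a => ⟨_, hc a⟩, rfl⟩
      have hp : l.Perm (l : Multiset (Fin n ⊕ Fin n)).toList := by
        rw [← Multiset.coe_eq_coe, Multiset.coe_toList]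
      rcases Nat.eq_zero_or_pos l.length with h0 | h0
      · have : l = [] := List.length_eq_zero_iff.mp h0
        subst this
        simpa using hw
      · have h2 := ih (l.length - 1) (by omega) (by omega) (word_perm hp)
        have h3 := add_mem h2 hw
        simpa using h3
  exact main e le_rfl

lemma V_finite (e : ℕ) : Module.Finite k (V k n e) := by
  have : Module.Finite k (Submodule.span k
    (Set.range fun f : Fin n ⊕ Fin n → Fin (e + 1) =>
      word k (∑ a, Multiset.replicate (f a : ℕ) a).toList)) :=
    FiniteDimensional.span_of_finite k (Set.finite_range _)
  exact Submodule.finiteDimensional_of_le (V_le_span e)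

lemma finrank_V_le (e : ℕ) : Module.finrank k (V k n e) ≤ (e + 1) ^ (n + n) := by
  have : Module.Finite k (Submodule.span k
    (Set.range fun f : Fin n ⊕ Fin n → Fin (e + 1) =>
      word k (∑ a, Multiset.replicate (f a : ℕ) a).toList)) :=
    FiniteDimensional.span_of_finite k (Set.finite_range _)
  refine (Submodule.finrank_mono (V_le_span e)).trans ?_
  refine (finrank_range_le_card _).trans ?_
  simp

/-- The left Ore condition, by comparing the growth of `V` with an exponential. -/
lemma exists_ore [CharZero k] (r s : WeylAlgebra k n) (hs : s ≠ 0) :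
    ∃ r₁ s₁ : WeylAlgebra k n, s₁ ≠ 0 ∧ s₁ * r = r₁ * s := by
  by_contra! hno
  obtain ⟨e₁, he₁⟩ := exists_mem_V r
  obtain ⟨e₂, he₂⟩ := exists_mem_V s
  set e := e₁ + e₂ with he
  have hr : r ∈ V k n e := V_mono (by omega) he₁
  have hs2 : s ∈ V k n e := V_mono (by omega) he₂
  have hdouble : ∀ N, 2 * Module.finrank k (V k n N) ≤ Module.finrank k (V k n (N + e)) := by
    intro N
    have := V_finite (k := k) (n := n) N
    have := V_finite (k := k) (n := n) (N + e)
    let φ : (V k n N × V k n N) →ₗ[k] V k n (N + e) :=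
      LinearMap.codRestrict _
        ((LinearMap.mulRight k r ∘ₗ (V k n N).subtype ∘ₗ LinearMap.fst k _ _)
          - (LinearMap.mulRight k s ∘ₗ (V k n N).subtype ∘ₗ LinearMap.snd k _ _))
        (fun u => sub_mem (mul_mem_V u.1.2 hr) (mul_mem_V u.2.2 hs2))
    have hφ : Function.Injective φ := by
      rw [injective_iff_map_eq_zero]
      rintro ⟨u, v⟩ huv
      have h1 : (u : WeylAlgebra k n) * r - v * s = 0 := congrArg Subtype.val huv
      have h2 : (u : WeylAlgebra k n) = 0 := by
        by_contra hu
        exact hno v u hu (sub_eq_zero.mp h1)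
      rw [h2, zero_mul, zero_sub, neg_eq_zero] at h1
      have h3 := (mul_eq_zero.mp h1).resolve_right hs
      exact Prod.ext (Subtype.ext h2) (Subtype.ext h3)
    have := LinearMap.finrank_le_finrank_of_injective hφ
    rw [Module.finrank_prod] at this
    omega
  have hpow : ∀ j, 2 ^ j ≤ Module.finrank k (V k n (j * e)) := by
    intro j
    induction j with
    | zero =>
      have := V_finite (k := k) (n := n) (0 * e)
      have hone : (1 : WeylAlgebra k n) ∈ V k n (0 * e) := by
        rw [← word_nil]
        exact word_mem (by simp)
      have : Nontrivial (V k n (0 * e)) :=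
        ⟨⟨1, hone⟩, 0, fun h => one_ne_zero (congrArg Subtype.val h)⟩
      exact Module.finrank_pos
    | succ j ih =>
      have := hdouble (j * e)
      rw [pow_succ, Nat.succ_mul]
      omega
  have hle : ∀ j : ℕ, (2 : ℝ) ^ j ≤ ((e + 1 : ℕ) : ℝ) ^ (n + n) * ((j + 1 : ℕ) : ℝ) ^ (n + n) := by
    intro j
    have h1 := (hpow j).trans (finrank_V_le (k := k) (n := n) (j * e))
    have h2 : j * e + 1 ≤ (e + 1) * (j + 1) := by nlinarith
    have h3 := h1.trans (Nat.pow_le_pow_left h2 (n + n))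
    rw [mul_pow] at h3
    exact_mod_cast h3
  have hlim := (tendsto_pow_const_div_const_pow_of_one_lt (n + n) (one_lt_two (α := ℝ))).comp
    (Filter.tendsto_add_atTop_nat 1)
  have hC : (0 : ℝ) < ((e + 1 : ℕ) : ℝ) ^ (n + n) := by positivity
  have hev := hlim.eventually (gt_mem_nhds (show (0 : ℝ) <
    (2 * ((e + 1 : ℕ) : ℝ) ^ (n + n))⁻¹ by positivity))
  obtain ⟨j, hj⟩ := hev.exists
  have h1 := hle j
  simp only [Function.comp_apply] at hj
  rw [div_lt_iff₀ (by positivity), pow_succ, inv_mul_eq_div, lt_div_iff₀ (by positivity)] at hj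
  nlinarith

instance oreSet [CharZero k] : OreLocalization.OreSet (WeylAlgebra k n)⁰ :=
  Classical.choice <| OreLocalization.nonempty_oreSet_iff_of_noZeroDivisors.mpr fun r s => by
    obtain ⟨r₁, s₁, hs₁, h⟩ := exists_ore r (s : WeylAlgebra k n) (nonZeroDivisors.coe_ne_zero s)
    exact ⟨r₁, ⟨s₁, mem_nonZeroDivisors_of_ne_zero hs₁⟩, h⟩

/-! ### Linear actions on the Weyl algebra -/

/-- The endomorphism of `A_n(k)` induced by `M ∈ GL_n(k)`:
`x_j ↦ ∑ i, M i j • x_i` and `∂_j ↦ ∑ i, M⁻¹ j i • ∂_i`. It is the conjugation of differential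
operators by the linear substitution `x_j ↦ ∑ i, M i j • x_i` of `k[x_1, …, x_n]`. -/
def act (M : GL (Fin n) k) : WeylAlgebra k n →ₐ[k] WeylAlgebra k n :=
  lift (fun j => ∑ i, (M : Matrix (Fin n) (Fin n) k) i j • x k i)
    (fun j => ∑ i, ((M⁻¹ : GL (Fin n) k) : Matrix (Fin n) (Fin n) k) j i • d k i)
    (fun i j => by
      simp only [Finset.sum_mul_sum, smul_mul_smul_comm]
      rw [Finset.sum_comm]
      refine Finset.sum_congr rfl fun a _ => Finset.sum_congr rfl fun b _ => ?_
      rw [x_mul_x, mul_comm])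
    (fun i j => by
      simp only [Finset.sum_mul_sum, smul_mul_smul_comm]
      rw [Finset.sum_comm]
      refine Finset.sum_congr rfl fun a _ => Finset.sum_congr rfl fun b _ => ?_
      rw [d_mul_d, mul_comm])
    (fun i j => by
      have h : ∑ a, ((M⁻¹ : GL (Fin n) k) : Matrix (Fin n) (Fin n) k) i a
          * (M : Matrix (Fin n) (Fin n) k) a j = if i = j then 1 else 0 := by
        rw [← Matrix.mul_apply, ← Units.val_mul, inv_mul_cancel, Units.val_one, Matrix.one_apply]
      have h2 : (if i = j then (1 : WeylAlgebra k n) else 0) =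
          (if i = j then (1 : k) else 0) • (1 : WeylAlgebra k n) := by
        split_ifs <;> simp
      rw [h2, ← h, Finset.sum_smul]
      simp only [Finset.sum_mul_sum, smul_mul_smul_comm, d_mul_x, smul_add, smul_ite, smul_zero,
        Finset.sum_add_distrib, Finset.sum_ite_eq, Finset.mem_univ, if_true]
      congr 1
      rw [Finset.sum_comm]
      refine Finset.sum_congr rfl fun a _ => Finset.sum_congr rfl fun b _ => ?_
      rw [mul_comm])

lemma act_x (M : GL (Fin n) k) (j : Fin n) :
    act M (x k j) = ∑ i, (M : Matrix (Fin n) (Fin n) k) i j • x k i := lift_x _ _ _ _ _ _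

lemma act_d (M : GL (Fin n) k) (j : Fin n) :
    act M (d k j) = ∑ i, ((M⁻¹ : GL (Fin n) k) : Matrix (Fin n) (Fin n) k) j i • d k i :=
  lift_d _ _ _ _ _ _

lemma act_one : act (1 : GL (Fin n) k) = AlgHom.id k (WeylAlgebra k n) := by
  refine algHom_ext (fun j => ?_) (fun j => ?_)
  · simp [act_x, Matrix.one_apply, ite_smul]
  · simp [act_d, Matrix.one_apply, ite_smul]

lemma act_mul (M N : GL (Fin n) k) : act (M * N) = (act M).comp (act N) := by
  refine algHom_ext (fun j => ?_) (fun j => ?_)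
  · simp only [AlgHom.comp_apply, act_x, map_sum, map_smul, Units.val_mul, Matrix.mul_apply,
      Finset.sum_smul, Finset.smul_sum, smul_smul]
    rw [Finset.sum_comm]
    refine Finset.sum_congr rfl fun a _ => Finset.sum_congr rfl fun b _ => ?_
    rw [mul_comm]
  · simp only [AlgHom.comp_apply, act_d, map_sum, map_smul, mul_inv_rev, Units.val_mul,
      Matrix.mul_apply, Finset.sum_smul, Finset.smul_sum, smul_smul]
    rw [Finset.sum_comm]

lemma act_injective (M : GL (Fin n) k) : Function.Injective (act M) := by
  refine Function.LeftInverse.injective (g := act M⁻¹) fun P => ?_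
  rw [← AlgHom.comp_apply, ← act_mul, inv_mul_cancel, act_one, AlgHom.id_apply]

end

end WeylAlgebra

/-! ### The Weyl field and its invariants -/

/-- The Weyl field `F_n(k)`: the skew field of (left) fractions of the Ore domain `A_n(k)`. -/
abbrev WeylField (k : Type*) [Field k] [CharZero k] (n : ℕ) : Type _ :=
  OreLocalization (WeylAlgebra k n)⁰ (WeylAlgebra k n)

namespace WeylField

noncomputable section

open OreLocalization

variable {k : Type*} [Field k] [CharZero k] {n : ℕ}

/-- The unit `s` of a skew field of fractions attached to a nonzero element, after applying
the automorphism given by `M`. -/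
def denomUnit (M : GL (Fin n) k) : (WeylAlgebra k n)⁰ →* (WeylField k n)ˣ where
  toFun s := Units.mk0 (numeratorHom (WeylAlgebra.act M s)) (by
    have h : numeratorHom (WeylAlgebra.act M s) ≠
        (numeratorHom (0 : WeylAlgebra k n) : WeylField k n) :=
      (numeratorHom_inj (S := (WeylAlgebra k n)⁰) inf_le_left).ne
        (fun h0 => nonZeroDivisors.coe_ne_zero s
          (WeylAlgebra.act_injective M (by rw [h0, map_zero])))
    rwa [show (numeratorHom (0 : WeylAlgebra k n) : WeylField k n) = 0 from
      map_zero (numeratorRingHom (S := (WeylAlgebra k n)⁰))] at h)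
  map_one' := by
    ext
    simp only [Submonoid.coe_one, map_one, Units.val_mk0, Units.val_one]
  map_mul' s t := by ext; simp

/-- The extension of `WeylAlgebra.act M` to the skew field of fractions,
`s⁻¹ r ↦ (act M s)⁻¹ (act M r)`. -/
def act (M : GL (Fin n) k) : WeylField k n →+* WeylField k n :=
  universalHom (numeratorRingHom.comp (WeylAlgebra.act M).toRingHom) (denomUnit M)
    (fun _ => rfl)

lemma act_numerator (M : GL (Fin n) k) (r : WeylAlgebra k n) :
    act M (numeratorHom r) = numeratorHom (WeylAlgebra.act M r) :=
  universalHom_commutes _ _ _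

lemma act_algebraMap (M : GL (Fin n) k) (c : k) :
    act M (algebraMap k (WeylField k n) c) = algebraMap k (WeylField k n) c := by
  refine (act_numerator M (algebraMap k _ c)).trans ?_
  rw [AlgHom.commutes]
  rfl

/-- For a linear representation `ρ : G → GL_n(k)`, the subalgebra `F_n(k)^G` of the elements of
the Weyl field which are fixed by every `g ∈ G`. -/
def invariants {G : Type*} [Group G] (ρ : G →* GL (Fin n) k) : Subalgebra k (WeylField k n) where
  carrier := {f | ∀ g : G, act (ρ g) f = f}
  mul_mem' ha hb g := by rw [map_mul, ha g, hb g]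
  add_mem' ha hb g := by rw [map_add, ha g, hb g]
  algebraMap_mem' c g := act_algebraMap (ρ g) c

end

end WeylField

/-! ### Purely transcendental extensions -/

/-- `L` is generated, as a field extension of `k`, by algebraically independent elements. -/
def IsPurelyTranscendental (k L : Type*) [Field k] [Field L] [Algebra k L] : Prop :=
  ∃ s : Set L, AlgebraicIndependent k ((↑) : s → L) ∧ IntermediateField.adjoin k s = ⊤

/-!
Write `F = F_n(k)`, and suppose that its skew subfield `E = F^G` is isomorphic to `F_m(L)`. The
argument uses two invariants of these skew fields: the centre, and the transcendence degree of
commutative subfields.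

**The centre of `E` is `k`** (`WeylField.exists_algebraMap_eq_of_commute_invariants`). Since `L` is
central in `F_m(L)`, this gives `L = k`, so `t = 0`. If `u P = α(P) u` for all `P` in the Weyl
algebra and some automorphism `α` of it, then `u` lies in the Weyl algebra because the latter is
simple, and comparing orders of nilpotency of the inner derivations of the generators gives `α = 1`
(`WeylField.eq_id_of_inner`). So `G` acts on `F` through outer automorphisms, and Artin's argument
on linear relations between automorphisms shows that an element commuting with the invariants is
central in `F` (`commute_of_commute_invariants`), that is, a scalar.

**A commutative subfield of `F_n(k)` has transcendence degree at most `n` over `k`**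
(`WeylField.card_le_of_mvPolynomial`). Applied to the images of `x_1, …, x_m` in `E ⊆ F_n(k)` this
gives `m ≤ n`. Applied to `n` algebraically independent elements of `k[x_1, …, x_n]^G`, which lie in
`E ≅ F_m(L)` with `L = k`, it gives `n ≤ m`.

The bound on the transcendence degree is proved by measuring growth. Let a field `K` act on `F` by
right multiplications, and consider the `K`-dimension of the span of `V_N f`, where `V_N` is the
Bernstein filtration of the Weyl algebra and `f ≠ 0`. Counting standard monomials shows that it is
either at least of order `N ^ (d + 1)`, with an explicit constant not depending on `f`, or at most
of order `N ^ d` (`growth_dichotomy`). By Bernstein's inequality its order is at least `n`, for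
every `K` (`WeylAlgebra.growthAtLeast_bernstein`). If `K'` contains an element `y` which is
transcendental over `K`, the spaces `V_N g f y ^ i` for `i < I` are independent over `K`, and for
a suitable `g ≠ 0` they are contained in `V_{N + N₀} f`. So the growth over `K` exceeds any
multiple of the growth over `K'`, and by the dichotomy its order is larger by at least one
(`WeylAlgebra.GrowthAtLeast.of_transcendental`). For a field of transcendence degree `d` this
yields growth of order `n + d` over the smallest field of a tower, whereas the order
is at most `2 n`.
-/

/-! ### Growth of filtered spaces spanned by monomials -/

section Growth

variable {σ K M : Type*} [LinearOrder σ] [Field K] [AddCommGroup M] [Module K M]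

/-- The span of the vectors whose exponent is smaller than `a` in the degree-lexicographic
order. -/
def lowerSpan (K : Type*) [Field K] [Module K M] (v : (σ →₀ ℕ) → M) (a : σ →₀ ℕ) :
    Submodule K M :=
  Submodule.span K (v '' {b | toDegLex b < toDegLex a})

/-- The standard exponents of a family `v`: those `a` for which `v a` is not a combination of the
vectors with smaller exponents. -/
def standardExponents (K : Type*) [Field K] [Module K M] (v : (σ →₀ ℕ) → M) : Set (σ →₀ ℕ) :=
  {a | v a ∉ lowerSpan K v a}

lemma toDegLex_lt_of_degree_lt {a b : σ →₀ ℕ} (h : a.degree < b.degree) :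
    toDegLex a < toDegLex b :=
  Finsupp.DegLex.lt_iff.mpr (Or.inl h)

lemma degree_le_of_toDegLex_lt {a b : σ →₀ ℕ} (h : toDegLex a < toDegLex b) :
    a.degree ≤ b.degree :=
  Finsupp.DegLex.monotone_degree h.le

/-- If multiplication by monomials is respected up to terms of lower degree, the standard
exponents form a down-set. -/
lemma mem_standardExponents_of_add {v : (σ →₀ ℕ) → M} {T : (σ →₀ ℕ) → M →ₗ[K] M}
    (hT : ∀ c a, T c (v a) - v (c + a) ∈
      Submodule.span K (v '' {b | b.degree < (c + a).degree}))
    {c a : σ →₀ ℕ} (h : c + a ∈ standardExponents K v) : a ∈ standardExponents K v := by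
  intro ha
  apply h
  have hle : ∀ b, Submodule.span K (v '' {x | x.degree < (c + b).degree}) ≤
      lowerSpan K v (c + b) := fun b =>
    Submodule.span_mono (Set.image_mono fun x hx => toDegLex_lt_of_degree_lt hx)
  have h1 : lowerSpan K v a ≤ (lowerSpan K v (c + a)).comap (T c) := by
    rw [lowerSpan, Submodule.span_le]
    rintro _ ⟨b, hb, rfl⟩
    have hlt : toDegLex (c + b) < toDegLex (c + a) := by
      rw [toDegLex_add, toDegLex_add]
      exact add_lt_add_right (show toDegLex b < toDegLex a from hb) _
    have h2 : v (c + b) ∈ lowerSpan K v (c + a) := Submodule.subset_span ⟨_, hlt, rfl⟩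
    have h3 : lowerSpan K v (c + b) ≤ lowerSpan K v (c + a) :=
      Submodule.span_mono (Set.image_mono fun x hx => lt_trans hx hlt)
    have h4 := add_mem (h3 (hle b (hT c b))) h2
    rw [sub_add_cancel] at h4
    exact h4
  have h5 := sub_mem (Submodule.mem_comap.mp (h1 ha)) (hle a (hT c a))
  rwa [sub_sub_cancel] at h5

lemma linearIndepOn_standardExponents (v : (σ →₀ ℕ) → M) (t : Finset (σ →₀ ℕ))
    (ht : ∀ a ∈ t, a ∈ standardExponents K v) : LinearIndepOn K v (t : Set (σ →₀ ℕ)) := by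
  induction t using Finset.induction_on_max_value (toDegLex : (σ →₀ ℕ) → _) with
  | empty => simp
  | insert a s has hmax ih =>
    rw [Finset.coe_insert, linearIndepOn_insert (by simpa using has)]
    refine ⟨ih fun b hb => ht b (Finset.mem_insert_of_mem hb), fun hmem => ?_⟩
    refine ht a (Finset.mem_insert_self _ _) (Submodule.span_mono (Set.image_mono ?_) hmem)
    intro b hb
    exact lt_of_le_of_ne (hmax b hb) fun h => has (toDegLex_injective h ▸ hb)

/-- The span of the vectors `v a` with `a` of degree at most `N`. -/
def degreeSpan (K : Type*) [Field K] [Module K M] (v : (σ →₀ ℕ) → M) (N : ℕ) : Submodule K M :=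
  Submodule.span K (v '' {b | b.degree ≤ N})

variable [Fintype σ]

open Classical in
/-- The standard exponents of degree at most `N`. -/
noncomputable def standardFinset (K : Type*) [Field K] [Module K M] (v : (σ →₀ ℕ) → M) (N : ℕ) :
    Finset (σ →₀ ℕ) :=
  (Finsupp.finite_of_degree_le (σ := σ) N).toFinset.filter (· ∈ standardExponents K v)

lemma mem_standardFinset {v : (σ →₀ ℕ) → M} {N : ℕ} {a : σ →₀ ℕ} :
    a ∈ standardFinset K v N ↔ a.degree ≤ N ∧ a ∈ standardExponents K v := by
  simp [standardFinset]

lemma finrank_degreeSpan (v : (σ →₀ ℕ) → M) (N : ℕ) :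
    Module.finrank K (degreeSpan K v N) = (standardFinset K v N).card := by
  have h1 : degreeSpan K v N = Submodule.span K (v '' (standardFinset K v N : Set (σ →₀ ℕ))) := by
    refine le_antisymm ?_ (Submodule.span_mono (Set.image_mono fun a ha =>
      (mem_standardFinset.mp ha).1))
    rw [degreeSpan, Submodule.span_le]
    rintro _ ⟨a, ha, rfl⟩
    suffices h : ∀ x : DegLex (σ →₀ ℕ), (ofDegLex x).degree ≤ N → v (ofDegLex x) ∈
        Submodule.span K (v '' (standardFinset K v N : Set (σ →₀ ℕ))) from h (toDegLex a) ha
    intro x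
    induction x using WellFoundedLT.induction with
    | ind x ih =>
      intro hx
      by_cases hs : ofDegLex x ∈ standardExponents K v
      · exact Submodule.subset_span ⟨_, mem_standardFinset.mpr ⟨hx, hs⟩, rfl⟩
      · have hs' : v (ofDegLex x) ∈ lowerSpan K v (ofDegLex x) := not_not.mp hs
        refine (Submodule.span_le.mpr ?_) hs'
        rintro _ ⟨b, hb, rfl⟩
        exact ih (toDegLex b) hb ((degree_le_of_toDegLex_lt hb).trans hx)
  have h2 := linearIndepOn_standardExponents (K := K) v (standardFinset K v N)
    fun a ha => (mem_standardFinset.mp ha).2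
  rw [h1, Set.image_eq_range]
  refine (finrank_span_eq_card (b := fun a : (standardFinset K v N) => v a) h2).trans ?_
  simp

lemma finrank_degreeSpan_le (v : (σ →₀ ℕ) → M) (N : ℕ) :
    Module.finrank K (degreeSpan K v N) ≤ (N + 1) ^ Fintype.card σ := by
  have h : (Fintype.piFinset fun _ : σ => Finset.range (N + 1)).card =
      (N + 1) ^ Fintype.card σ := by simp
  rw [finrank_degreeSpan, ← h]
  refine Finset.card_le_card_of_injOn (fun a => (a : σ → ℕ)) ?_ DFunLike.coe_injective.injOn
  intro a ha
  refine Fintype.mem_piFinset.mpr fun i => Finset.mem_range.mpr ?_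
  change a i < N + 1
  have h1 : a i ≤ a.degree := Finsupp.le_degree i a
  have h2 := (mem_standardFinset.mp ha).1
  omega

/-- The standard exponents form a down-set. Either it contains a coordinate subspace of dimension
`d + 1`, and the dimension grows at least like `N ^ (d + 1)`, or the dimension grows at most like
`N ^ d`. -/
theorem growth_dichotomy {v : (σ →₀ ℕ) → M} {T : (σ →₀ ℕ) → M →ₗ[K] M}
    (hT : ∀ c a, T c (v a) - v (c + a) ∈
      Submodule.span K (v '' {b | b.degree < (c + a).degree})) (d : ℕ) :
    (∀ N, (N + 1) ^ (d + 1) ≤ Module.finrank K (degreeSpan K v (Fintype.card σ * N))) ∨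
      ∃ C, ∀ N, Module.finrank K (degreeSpan K v N) ≤ C * (N + 1) ^ d := by
  classical
  simp only [finrank_degreeSpan]
  have hdown : ∀ a b : σ →₀ ℕ, a ≤ b → b ∈ standardExponents K v →
      a ∈ standardExponents K v := by
    intro a b hab hb
    rw [← tsub_add_cancel_of_le hab] at hb
    exact mem_standardExponents_of_add hT hb
  by_cases hA : ∃ A : Finset σ, A.card = d + 1 ∧
      ∀ a : σ →₀ ℕ, a.support ⊆ A → a ∈ standardExponents K v
  · left
    intro N
    obtain ⟨A, hAc, hA⟩ := hA
    let t : Finset (σ → ℕ) :=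
      Fintype.piFinset fun i => if i ∈ A then Finset.range (N + 1) else {0}
    have ht : t.card = (N + 1) ^ (d + 1) := by
      rw [Fintype.card_piFinset, ← hAc]
      have : ∀ i, (if i ∈ A then Finset.range (N + 1) else {0}).card =
          if i ∈ A then N + 1 else 1 := fun i => by split_ifs <;> simp
      simp only [this]
      rw [Finset.prod_ite_mem, Finset.univ_inter, Finset.prod_const]
    rw [← ht]
    refine Finset.card_le_card_of_injOn (fun f => Finsupp.equivFunOnFinite.symm f) ?_
      (Finsupp.equivFunOnFinite.symm.injective.injOn)
    intro f hf
    have hf : ∀ i, f i ∈ if i ∈ A then Finset.range (N + 1) else {0} :=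
      Fintype.mem_piFinset.mp hf
    refine mem_standardFinset.mpr ⟨?_, hA _ ?_⟩
    · rw [Finsupp.degree_eq_sum, Fintype.card, ← smul_eq_mul]
      refine Finset.sum_le_card_nsmul _ _ _ fun i _ => ?_
      have := hf i
      simp only [Finsupp.equivFunOnFinite_symm_apply_apply]
      split_ifs at this
      · have := Finset.mem_range.mp this
        omega
      · have := Finset.mem_singleton.mp this
        omega
    · intro i hi
      by_contra hiA
      have := hf i
      rw [if_neg hiA, Finset.mem_singleton] at this
      simp [this] at hi
  · -- otherwise fewer than `d + 1` of the coordinates of a standard exponent can be large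
    right
    push Not at hA
    choose! g hg hgn using hA
    -- a uniform bound for the exponents occurring in the nonstandard monomials `g A`
    obtain ⟨D, hD⟩ : ∃ D, 0 < D ∧ ∀ A i, g A i ≤ D := by
      refine ⟨(∑ A, ∑ i, g A i) + 1, by omega, fun A i => ?_⟩
      have h1 : g A i ≤ ∑ i, g A i :=
        Finset.single_le_sum (fun _ _ => Nat.zero_le _) (Finset.mem_univ i)
      have h2 : ∑ i, g A i ≤ ∑ A, ∑ i, g A i :=
        Finset.single_le_sum (f := fun A => ∑ i, g A i) (fun _ _ => Nat.zero_le _)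
          (Finset.mem_univ A)
      omega
    refine ⟨2 ^ Fintype.card σ * D ^ Fintype.card σ, fun N => ?_⟩
    let B : Finset (Finset σ) := Finset.univ.filter fun A => A.card ≤ d
    let t : Finset σ → Finset (σ → ℕ) := fun A =>
      Fintype.piFinset fun i => if i ∈ A then Finset.range (N + 1) else Finset.range D
    have ht : ∀ A ∈ B, (t A).card ≤ D ^ Fintype.card σ * (N + 1) ^ d := by
      intro A hAB
      have hAB : A.card ≤ d := (Finset.mem_filter.mp hAB).2
      rw [Fintype.card_piFinset]
      have h1 : ∀ i, (if i ∈ A then Finset.range (N + 1) else Finset.range D).card ≤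
          D * if i ∈ A then N + 1 else 1 := fun i => by
        split_ifs
        · rw [Finset.card_range]
          exact Nat.le_mul_of_pos_left _ hD.1
        · simp
      refine (Finset.prod_le_prod' fun i _ => h1 i).trans ?_
      rw [Finset.prod_mul_distrib, Finset.prod_const, Finset.card_univ, Finset.prod_ite_mem,
        Finset.univ_inter, Finset.prod_const]
      exact Nat.mul_le_mul_left _ (Nat.pow_le_pow_right (by omega) hAB)
    have hsub : (standardFinset K v N).card ≤ (B.biUnion t).card := by
      refine Finset.card_le_card_of_injOn (fun a => (a : σ → ℕ)) ?_ DFunLike.coe_injective.injOn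
      intro a ha
      obtain ⟨haN, haS⟩ := mem_standardFinset.mp ha
      refine Finset.mem_coe.mpr (Finset.mem_biUnion.mpr
        ⟨Finset.univ.filter fun i => D ≤ a i, ?_, ?_⟩)
      · refine Finset.mem_filter.mpr ⟨Finset.mem_univ _, ?_⟩
        by_contra! hcard
        obtain ⟨A, hAs, hAc⟩ := Finset.exists_subset_card_eq (Nat.succ_le_of_lt hcard)
        refine hgn A hAc (hdown _ a (fun i => ?_) haS)
        by_cases hi : i ∈ A
        · exact (hD.2 A i).trans (Finset.mem_filter.mp (hAs hi)).2
        · have : g A i = 0 := by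
            by_contra h0
            exact hi (hg A hAc (Finsupp.mem_support_iff.mpr h0))
          omega
      · refine Fintype.mem_piFinset.mpr fun i => ?_
        by_cases hi : D ≤ a i
        · have h1 : a i ≤ a.degree := Finsupp.le_degree i a
          simp only [Finset.mem_filter, Finset.mem_univ, true_and, hi, if_true]
          exact Finset.mem_range.mpr (by omega)
        · simp only [Finset.mem_filter, Finset.mem_univ, true_and, hi, if_false]
          exact Finset.mem_range.mpr (by omega)
    refine hsub.trans (Finset.card_biUnion_le.trans ((Finset.sum_le_card_nsmul _ _ _ ht).trans ?_))
    rw [smul_eq_mul, mul_assoc]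
    refine Nat.mul_le_mul_right _ ((Finset.card_filter_le _ _).trans ?_)
    simp

end Growth

/-! ### The Bernstein filtration -/

namespace WeylAlgebra

section Monomials

variable {k : Type*} [Field k] {n : ℕ}

variable (k) in
/-- The monomial of the Weyl algebra with exponent `a`, as a product of generators in some
order; another order changes it by terms of lower degree only. The exponents are indexed by
`Fin (n + n)` rather than `Fin n ⊕ Fin n` in order to have the linear order needed for the
degree-lexicographic order. -/
noncomputable def monomialWord (a : Fin (n + n) →₀ ℕ) : WeylAlgebra k n :=
  word k (a.toMultiset.map finSumFinEquiv.symm).toList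

lemma length_monomialWord (a : Fin (n + n) →₀ ℕ) :
    (a.toMultiset.map (finSumFinEquiv (m := n) (n := n)).symm).toList.length = a.degree := by
  rw [Multiset.length_toList, Multiset.card_map, Finsupp.card_toMultiset, Finsupp.degree_eq_sum,
    Finsupp.sum_fintype _ _ (fun _ => rfl)]
  rfl

lemma exists_perm_monomialWord (l : List (Fin n ⊕ Fin n)) : ∃ a : Fin (n + n) →₀ ℕ,
    l.Perm (a.toMultiset.map (finSumFinEquiv (m := n) (n := n)).symm).toList := by
  refine ⟨Multiset.toFinsupp ((l : Multiset (Fin n ⊕ Fin n)).map finSumFinEquiv), ?_⟩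
  rw [← Multiset.coe_eq_coe, Multiset.coe_toList, Multiset.toFinsupp_toMultiset,
    Multiset.map_map]
  simp

lemma V_eq_degreeSpan (N : ℕ) : V k n N = degreeSpan k (monomialWord k (n := n)) N := by
  refine le_antisymm ?_ (Submodule.span_le.mpr ?_)
  · induction N using Nat.strong_induction_on with
    | _ N ih =>
      rw [V, Submodule.span_le]
      rintro _ ⟨l, hl, rfl⟩
      have hl : l.length ≤ N := hl
      obtain ⟨a, ha⟩ := exists_perm_monomialWord l
      have hdeg : a.degree = l.length := by rw [ha.length_eq, length_monomialWord]
      have hmem : monomialWord k a ∈ degreeSpan k (monomialWord k (n := n)) N :=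
        Submodule.subset_span ⟨a, by simpa [hdeg] using hl, rfl⟩
      rcases Nat.eq_zero_or_pos l.length with h0 | h0
      · obtain rfl := List.length_eq_zero_iff.mp h0
        have : word k [] = monomialWord k a := by rw [monomialWord, ← ha.nil_eq]
        rw [this]
        exact hmem
      · have h1 := ih (l.length - 1) (by omega) (word_perm ha)
        have h2 : degreeSpan k (monomialWord k (n := n)) (l.length - 1) ≤
            degreeSpan k (monomialWord k (n := n)) N :=
          Submodule.span_mono (Set.image_mono fun b (hb : b.degree ≤ _) =>
            show b.degree ≤ N by omega)
        have h3 := add_mem (h2 h1) hmem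
        change word k l - monomialWord k a + monomialWord k a ∈ _ at h3
        rw [sub_add_cancel] at h3
        exact h3
  · rintro _ ⟨a, ha, rfl⟩
    exact word_mem (by rw [length_monomialWord]; exact ha)

lemma word_sub_word_mem {l l' : List (Fin n ⊕ Fin n)} (h : l.Perm l') :
    word k l - word k l' ∈
      Submodule.span k (monomialWord k (n := n) '' {b | b.degree < l.length}) := by
  rcases Nat.eq_zero_or_pos l.length with h0 | h0
  · obtain rfl := List.length_eq_zero_iff.mp h0
    rw [← h.nil_eq, sub_self]
    exact zero_mem _
  · have h1 := word_perm (k := k) h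
    rw [V_eq_degreeSpan] at h1
    refine Submodule.span_mono (Set.image_mono fun b hb => ?_) h1
    have hb : b.degree ≤ l.length - 1 := hb
    change b.degree < l.length
    omega

lemma monomialWord_mul_sub_mem (c a : Fin (n + n) →₀ ℕ) :
    monomialWord k c * monomialWord k a - monomialWord k (c + a) ∈
      Submodule.span k (monomialWord k (n := n) '' {b | b.degree < (c + a).degree}) := by
  rw [monomialWord, monomialWord, ← word_append]
  have hp : ((c.toMultiset.map (finSumFinEquiv (m := n) (n := n)).symm).toList ++
      (a.toMultiset.map finSumFinEquiv.symm).toList).Perm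
      ((c + a).toMultiset.map finSumFinEquiv.symm).toList := by
    rw [← Multiset.coe_eq_coe, ← Multiset.coe_add]
    simp
  have h := word_sub_word_mem (k := k) hp
  rwa [hp.length_eq, length_monomialWord] at h

/-- The generator `a.swap` is conjugate to `a` and commutes with the other generators. -/
lemma om_swap (a b : Fin n ⊕ Fin n) : (om a.swap b : k) ≠ 0 ↔ a = b := by
  rcases a with i | i <;> rcases b with j | j <;> simp [om, eq_comm]

lemma ad_gen_pow (b a : Fin n ⊕ Fin n) (i : ℕ) :
    ad k b (gen k a ^ (i + 1)) = ((i + 1 : ℕ) * om b a : k) • gen k a ^ i := by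
  induction i with
  | zero => simp [ad_gen, Algebra.algebraMap_eq_smul_one]
  | succ i ih =>
    rw [pow_succ, ad_mul, ih, ad_gen, Algebra.algebraMap_eq_smul_one, mul_smul_comm, mul_one,
      smul_mul_assoc, ← pow_succ, ← add_smul]
    push_cast
    ring_nf

variable [CharZero k]

/-- The powers of a generator are linearly independent over the kernel of the inner derivation
given by the conjugate generator. -/
lemma eq_zero_of_sum_gen_pow_mul (a : Fin n ⊕ Fin n) (N : ℕ) (q : ℕ → WeylAlgebra k n)
    (hq : ∀ i, ad k a.swap (q i) = 0) (h : ∑ i ∈ Finset.range N, gen k a ^ i * q i = 0) :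
    ∀ i < N, q i = 0 := by
  induction N generalizing q with
  | zero => simp
  | succ N ih =>
    have h1 := congrArg (ad k a.swap) h
    rw [Finset.sum_range_succ', map_add, map_sum, map_zero] at h1
    simp only [ad_mul, hq, mul_zero, add_zero, pow_zero, one_mul, ad_gen_pow] at h1
    have hc : (om a.swap a : k) ≠ 0 := (om_swap a a).mpr rfl
    have h2 := ih (fun i => ((i + 1 : ℕ) * om a.swap a : k) • q (i + 1))
      (fun i => by rw [map_smul, hq, smul_zero])
      (by rw [← h1]; exact Finset.sum_congr rfl fun i _ => by simp)
    have h3 : ∀ i < N, q (i + 1) = 0 := fun i hi =>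
      (smul_eq_zero.mp (h2 i hi)).resolve_left
        (mul_ne_zero (Nat.cast_ne_zero.mpr (Nat.succ_ne_zero i)) hc)
    rw [Finset.sum_range_succ', Finset.sum_eq_zero, zero_add, pow_zero, one_mul] at h
    · intro i hi
      rcases i with _ | i
      · exact h
      · exact h3 i (by omega)
    · intro i hi
      rw [h3 i (Finset.mem_range.mp hi), mul_zero]

/-- The half of the Poincaré–Birkhoff–Witt theorem bounding dimensions from below: `U` is the span
of the ordered monomials in the generators from `S` with all exponents at most `N`. -/
lemma exists_box (N : ℕ) (S : Finset (Fin n ⊕ Fin n)) : ∃ U : Submodule k (WeylAlgebra k n),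
    U ≤ V k n (S.card * N) ∧ (∀ a ∉ S, ∀ P ∈ U, ad k a.swap P = 0) ∧
      (N + 1) ^ S.card ≤ Module.finrank k U := by
  classical
  induction S using Finset.induction_on with
  | empty =>
    refine ⟨V k n 0, by simp, fun a _ P hP => ad_eq_zero _ hP, ?_⟩
    have := V_finite (k := k) (n := n) 0
    have : Nontrivial (V k n 0) :=
      ⟨⟨1, word_mem (l := []) le_rfl⟩, 0, fun h => one_ne_zero (congrArg Subtype.val h)⟩
    rw [Finset.card_empty, pow_zero]
    exact Module.finrank_pos (R := k) (M := V k n 0)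
  | insert a S ha ih =>
    obtain ⟨U, hUV, hU, hdim⟩ := ih
    have := V_finite (k := k) (n := n) (S.card * N)
    have : Module.Finite k U := Submodule.finiteDimensional_of_le hUV
    let φ : (Fin (N + 1) → U) →ₗ[k] WeylAlgebra k n :=
      ∑ i : Fin (N + 1), LinearMap.mulLeft k (gen k a ^ (i : ℕ)) ∘ₗ U.subtype ∘ₗ LinearMap.proj i
    have hφ : ∀ q, φ q = ∑ i : Fin (N + 1), gen k a ^ (i : ℕ) * (q i : WeylAlgebra k n) :=
      fun q => by simp [φ]
    have hinj : Function.Injective φ := by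
      rw [injective_iff_map_eq_zero]
      intro q hq
      let q' : ℕ → WeylAlgebra k n := fun i => if h : i < N + 1 then q ⟨i, h⟩ else 0
      have hq' : ∀ i : Fin (N + 1), q' i = q i := fun i => dif_pos i.2
      have h := eq_zero_of_sum_gen_pow_mul a (N + 1) q'
        (fun i => by
          by_cases h : i < N + 1
          · rw [hq' ⟨i, h⟩]
            exact hU a ha _ (q ⟨i, h⟩).2
          · rw [show q' i = 0 from dif_neg h, map_zero])
        (by
          rw [← hq, hφ, ← Fin.sum_univ_eq_sum_range (fun i => gen k a ^ i * q' i)]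
          exact Finset.sum_congr rfl fun i _ => by rw [hq'])
      funext i
      have := h i i.2
      rw [hq'] at this
      exact Subtype.ext this
    have hpow : ∀ i : ℕ, gen k a ^ i ∈ V k n i := fun i => by
      have := word_mem (k := k) (l := List.replicate i a) (e := i) (by simp)
      simpa [word] using this
    refine ⟨LinearMap.range φ, ?_, ?_, ?_⟩
    · rintro _ ⟨q, rfl⟩
      rw [hφ]
      refine Submodule.sum_mem _ fun i _ => V_mono ?_ (mul_mem_V (hpow i) (hUV (q i).2))
      rw [Finset.card_insert_of_notMem ha, Nat.succ_mul]
      omega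
    · rintro b hb _ ⟨q, rfl⟩
      rw [hφ, map_sum]
      refine Finset.sum_eq_zero fun i _ => ?_
      have hba : ¬ b = a := fun h => hb (h ▸ Finset.mem_insert_self _ _)
      have h0 : (om b.swap a : k) = 0 := not_not.mp ((om_swap b a).not.mpr hba)
      have h1 : ad k b.swap (gen k a ^ (i : ℕ)) = 0 := by
        rcases (i : ℕ) with _ | j
        · simp [ad_one]
        · rw [ad_gen_pow, h0, mul_zero, zero_smul]
      rw [ad_mul, h1, zero_mul, hU b (fun h => hb (Finset.mem_insert_of_mem h)) _ (q i).2,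
        mul_zero, add_zero]
    · rw [LinearMap.finrank_range_of_inj hinj, Module.finrank_pi_fintype, Finset.sum_const,
        Finset.card_univ, Fintype.card_fin, smul_eq_mul, Finset.card_insert_of_notMem ha, pow_succ,
        mul_comm]
      exact Nat.mul_le_mul_left _ hdim

lemma le_finrank_V (N : ℕ) : (N + 1) ^ (n + n) ≤ Module.finrank k (V k n ((n + n) * N)) := by
  obtain ⟨U, hUV, -, hdim⟩ := exists_box (k := k) (n := n) N Finset.univ
  have hc : (Finset.univ : Finset (Fin n ⊕ Fin n)).card = n + n := by simp
  rw [hc] at hUV hdim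
  have := V_finite (k := k) (n := n) ((n + n) * N)
  exact hdim.trans (Submodule.finrank_mono hUV)

end Monomials

end WeylAlgebra

/-! ### Growth of modules over the Weyl algebra -/

namespace WeylAlgebra

section Growth

variable {k : Type*} [Field k] {n : ℕ} {M : Type*} [AddCommGroup M]
  [Module (WeylAlgebra k n) M] (K : Type*) [Field K] [Module K M]

variable (k n) in
/-- The `K`-span of `V k n N • f`, where the field `K` acts on the module `M` by
endomorphisms. It is written as the span of the vectors `w • f` for the monomials `w` of degree at
most `N`. -/
noncomputable def weylSpan (f : M) (N : ℕ) : Submodule K M :=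
  degreeSpan K (fun a => monomialWord k (n := n) a • f) N

lemma finrank_weylSpan_le (f : M) (N : ℕ) :
    Module.finrank K (weylSpan k n K f N) ≤ (N + 1) ^ (n + n) := by
  have h := finrank_degreeSpan_le (K := K) (fun a => monomialWord k (n := n) a • f) N
  rwa [Fintype.card_fin] at h

instance (f : M) (N : ℕ) : Module.Finite K (weylSpan k n K f N) :=
  FiniteDimensional.span_of_finite K ((Finsupp.finite_of_degree_le N).image _)

section ScalarTower

variable [Module k M] [IsScalarTower k (WeylAlgebra k n) M] [Algebra k K] [IsScalarTower k K M]

lemma smul_mem_span (f : M) {s : Set (Fin (n + n) →₀ ℕ)} {P : WeylAlgebra k n}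
    (hP : P ∈ Submodule.span k (monomialWord k (n := n) '' s)) :
    P • f ∈ Submodule.span K ((fun a => monomialWord k (n := n) a • f) '' s) := by
  induction hP using Submodule.span_induction with
  | mem P hP =>
    obtain ⟨a, ha, rfl⟩ := hP
    exact Submodule.subset_span ⟨a, ha, rfl⟩
  | zero => rw [zero_smul]; exact zero_mem _
  | add P Q _ _ hP hQ => rw [add_smul]; exact add_mem hP hQ
  | smul c P _ hP =>
    rw [smul_assoc, ← algebraMap_smul K c (P • f)]
    exact Submodule.smul_mem _ _ hP

lemma smul_mem_weylSpan (f : M) {N : ℕ} {P : WeylAlgebra k n} (hP : P ∈ V k n N) :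
    P • f ∈ weylSpan k n K f N :=
  smul_mem_span K f (by rw [V_eq_degreeSpan] at hP; exact hP)

end ScalarTower

/-! ### Bernstein's inequality -/

variable [SMulCommClass (WeylAlgebra k n) K M]

variable (k n M) in
/-- The action on `M` of the Weyl algebra over the larger field `K`. -/
noncomputable def extendScalars : WeylAlgebra K n →ₐ[K] Module.End K M :=
  lift (fun i => DistribSMul.toLinearMap K M (x k i))
    (fun i => DistribSMul.toLinearMap K M (d k i))
    (fun i j => LinearMap.ext fun m => by
      simp only [Module.End.mul_apply, DistribSMul.toLinearMap_apply, ← mul_smul, x_mul_x i j])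
    (fun i j => LinearMap.ext fun m => by
      simp only [Module.End.mul_apply, DistribSMul.toLinearMap_apply, ← mul_smul, d_mul_d i j])
    (fun i j => LinearMap.ext fun m => by
      rw [LinearMap.add_apply]
      simp only [Module.End.mul_apply, DistribSMul.toLinearMap_apply, ← mul_smul, d_mul_x i j,
        add_smul]
      split_ifs <;> simp)

lemma extendScalars_word (l : List (Fin n ⊕ Fin n)) (m : M) :
    extendScalars k n M K (word K l) m = word k l • m := by
  induction l generalizing m with
  | nil => simp [word_nil]
  | cons a l ih =>
    rw [word_cons, word_cons, map_mul, Module.End.mul_apply, ih, mul_smul]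
    rcases a with i | i
    · exact congrArg (fun φ : Module.End K M => φ (word k l • m)) (lift_x _ _ _ _ _ i)
    · exact congrArg (fun φ : Module.End K M => φ (word k l • m)) (lift_d _ _ _ _ _ i)

lemma weylSpan_eq_map (f : M) (N : ℕ) : weylSpan k n K f N =
    (V K n N).map ((LinearMap.applyₗ f) ∘ₗ (extendScalars k n M K).toLinearMap) := by
  rw [V_eq_degreeSpan, degreeSpan, Submodule.map_span, Set.image_image]
  simp only [weylSpan, degreeSpan, LinearMap.comp_apply, AlgHom.toLinearMap_apply,
    LinearMap.applyₗ_apply_apply, monomialWord, extendScalars_word]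

/-- An element of `V K n N` which annihilates `V K n N • f` commutes with the generators by
induction on `N`, hence is a scalar. -/
lemma eq_zero_of_annihilates [CharZero K] {f : M} (hf : f ≠ 0) {N : ℕ} {P : WeylAlgebra K n}
    (hP : P ∈ V K n N)
    (h : ∀ Q ∈ V K n N, extendScalars k n M K (P * Q) f = 0) : P = 0 := by
  have hone : ∀ e, (1 : WeylAlgebra K n) ∈ V K n e := fun e => word_mem (l := []) (Nat.zero_le e)
  have key : ∀ {P : WeylAlgebra K n} {N : ℕ}, P ∈ V K n 0 →
      (∀ Q ∈ V K n N, extendScalars k n M K (P * Q) f = 0) → P = 0 := by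
    intro P N hP h
    obtain ⟨c, rfl⟩ := exists_algebraMap_eq hP
    have h1 := h 1 (hone N)
    rw [mul_one, AlgHom.commutes, Module.algebraMap_end_apply] at h1
    rw [(smul_eq_zero.mp h1).resolve_right hf, map_zero]
  induction N generalizing P with
  | zero => exact key hP h
  | succ N ih =>
    have hmem : ∀ a, ad K a P ∈ V K n N := fun a => by
      have h1 := ad_mem a hP
      rwa [Nat.add_sub_cancel] at h1
    refine key (mem_V_zero_of_central fun a => ih (hmem a) fun Q hQ => ?_) h
    rw [ad_apply, sub_mul, map_sub, LinearMap.sub_apply, mul_assoc, map_mul, Module.End.mul_apply,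
      h Q (V_mono (Nat.le_succ N) hQ), map_zero, mul_assoc, h _ (gen_mul_mem a hQ), sub_zero]

lemma finrank_V_le_mul [CharZero K] {f : M} (hf : f ≠ 0) (N : ℕ) :
    Module.finrank K (V K n N) ≤
      Module.finrank K (weylSpan k n K f N) * Module.finrank K (weylSpan k n K f (N + N)) := by
  have hmaps : ∀ P ∈ V K n N, ∀ m ∈ weylSpan k n K f N,
      extendScalars k n M K P m ∈ weylSpan k n K f (N + N) := by
    intro P hP m hm
    rw [weylSpan_eq_map] at hm ⊢
    obtain ⟨Q, hQ, rfl⟩ := hm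
    exact ⟨P * Q, mul_mem_V hP hQ, by simp⟩
  let φ : V K n N →ₗ[K] weylSpan k n K f N →ₗ[K] weylSpan k n K f (N + N) :=
    { toFun := fun P => (extendScalars k n M K P).restrict (hmaps P P.2)
      map_add' := fun P Q => LinearMap.ext fun m => Subtype.ext (by simp)
      map_smul' := fun c P => LinearMap.ext fun m => Subtype.ext (by simp) }
  have hφ : Function.Injective φ := by
    rw [injective_iff_map_eq_zero]
    intro P hP
    refine Subtype.ext (eq_zero_of_annihilates (k := k) K hf P.2 fun Q hQ => ?_)
    have hm : extendScalars k n M K Q f ∈ weylSpan k n K f N := by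
      rw [weylSpan_eq_map]
      exact ⟨Q, hQ, rfl⟩
    have h1 := congrArg Subtype.val (LinearMap.congr_fun hP ⟨_, hm⟩)
    rw [map_mul]
    exact h1
  have h := LinearMap.finrank_le_finrank_of_injective hφ
  rwa [Module.finrank_linearMap] at h

variable (k n M) in
/-- Every nonzero cyclic submodule `WeylAlgebra k n • f` of `M` has growth of degree at least `d`,
when dimensions are measured over the field `K`. The bound is required with the same constants for
all `f`, which is what allows the degree to be raised in `GrowthAtLeast.of_transcendental`. -/
def GrowthAtLeast (d : ℕ) : Prop :=
  ∀ f : M, f ≠ 0 → ∀ N, (N + 1) ^ d ≤ Module.finrank K (weylSpan k n K f ((n + n) * N))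

variable [Module k M] [IsScalarTower k (WeylAlgebra k n) M] [Algebra k K] [IsScalarTower k K M]

theorem weylSpan_dichotomy (f : M) (d : ℕ) :
    (∀ N, (N + 1) ^ (d + 1) ≤ Module.finrank K (weylSpan k n K f ((n + n) * N))) ∨
      ∃ C, ∀ N, Module.finrank K (weylSpan k n K f N) ≤ C * (N + 1) ^ d := by
  have h := growth_dichotomy (K := K) (v := fun a => monomialWord k (n := n) a • f)
    (T := fun c => DistribSMul.toLinearMap K M (monomialWord k c))
    (fun c a => by
      rw [DistribSMul.toLinearMap_apply, ← mul_smul, ← sub_smul]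
      exact smul_mem_span K f (monomialWord_mul_sub_mem c a)) d
  rwa [Fintype.card_fin] at h

/-- Bernstein's inequality: nonzero modules over the `n`-th Weyl algebra have growth of degree at
least `n`. -/
theorem growthAtLeast_bernstein [CharZero K] : GrowthAtLeast k n M K n := by
  intro f hf N
  obtain _ | d := n
  · rw [pow_zero]
    have : Nontrivial (weylSpan k 0 K f ((0 + 0) * N)) := by
      refine ⟨⟨f, ?_⟩, 0, fun h => hf (congrArg Subtype.val h)⟩
      have h := smul_mem_weylSpan (k := k) (n := 0) K f
        (word_mem (k := k) (l := []) (Nat.zero_le ((0 + 0) * N)))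
      rwa [word_nil, one_smul] at h
    exact Module.finrank_pos
  · rcases weylSpan_dichotomy (k := k) (n := d + 1) K f d with h | ⟨C, hC⟩
    · exact h N
    · -- growth of degree `d` is too small, as the growth of the Weyl algebra has degree `2 (d + 1)`
      exfalso
      set s := d + 1 + (d + 1) with hs
      have h1 : ∀ N, (N + 1) ^ s ≤ C ^ 2 * (2 * s + 1) ^ (d + d) * (N + 1) ^ (d + d) := by
        intro N
        have hb : ∀ e, e ≤ 2 * s * N →
            C * (e + 1) ^ d ≤ C * ((2 * s + 1) ^ d * (N + 1) ^ d) := by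
          intro e he
          rw [← mul_pow]
          exact Nat.mul_le_mul_left _ (Nat.pow_le_pow_left (by nlinarith) d)
        calc (N + 1) ^ s ≤ Module.finrank K (V K (d + 1) (s * N)) := le_finrank_V N
          _ ≤ _ := finrank_V_le_mul (k := k) K hf (s * N)
          _ ≤ (C * ((2 * s + 1) ^ d * (N + 1) ^ d)) * (C * ((2 * s + 1) ^ d * (N + 1) ^ d)) :=
            Nat.mul_le_mul ((hC _).trans (hb _ (by nlinarith)))
              ((hC _).trans (hb _ (by nlinarith)))
          _ = _ := by ring
      set B := C ^ 2 * (2 * s + 1) ^ (d + d)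
      have h2 := h1 B
      have h3 : (B + 1) ^ s = (B + 1) ^ 2 * (B + 1) ^ (d + d) := by
        rw [← pow_add]
        congr 1
        omega
      rw [h3] at h2
      have h4 := Nat.le_of_mul_le_mul_right h2 (by positivity)
      nlinarith

end Growth

end WeylAlgebra

/-! ### Commuting subfields have transcendence degree at most `n` -/

namespace WeylAlgebra

section Jump

variable {k : Type*} [Field k] {n : ℕ} {M : Type*} [AddCommGroup M]
  [Module (WeylAlgebra k n) M]

/-- In a torsion-free module of rank one, finitely many elements are brought into a given nonzero
cyclic submodule by a common nonzero multiplier. -/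
lemma exists_common_multiplier [CharZero k]
    (hrank : ∀ f f' : M, f ≠ 0 → ∃ g r : WeylAlgebra k n, g ≠ 0 ∧ g • f' = r • f)
    {f : M} (hf : f ≠ 0) (u : ℕ → M) (I : ℕ) :
    ∃ (g : WeylAlgebra k n) (r : ℕ → WeylAlgebra k n), g ≠ 0 ∧ ∀ i < I, g • u i = r i • f := by
  induction I with
  | zero => exact ⟨1, fun _ => 1, one_ne_zero, by simp⟩
  | succ I ih =>
    obtain ⟨g, r, hg, h⟩ := ih
    obtain ⟨g', r', hg', h'⟩ := hrank f (g • u I) hf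
    refine ⟨g' * g, fun i => if i = I then r' else g' * r i, mul_ne_zero hg' hg, fun i hi => ?_⟩
    rcases Nat.lt_succ_iff_lt_or_eq.mp hi with hi | rfl
    · simp only [if_neg hi.ne, mul_smul, h i hi]
    · simp only [if_true, mul_smul, h']

variable (K K' : Type*) [Field K] [Field K'] [Algebra K K'] [Module K M] [Module K' M]
  [IsScalarTower K K' M]
  [Module k M] [IsScalarTower k (WeylAlgebra k n) M] [Algebra k K] [IsScalarTower k K M]
  [SMulCommClass (WeylAlgebra k n) K' M]

/-- If `g • y ^ i • f` lies in `V k n N₀ • f` for `i < I`, then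
`V k n (N + N₀) • f` contains `V k n N • g • y ^ i • f` for `i < I`, and these spaces are
independent over `K` when `y` is transcendental over `K`. -/
lemma mul_finrank_weylSpan_le {y : K'} (hy : Transcendental K y) {f : M}
    {g : WeylAlgebra k n} {r : ℕ → WeylAlgebra k n} {I N₀ : ℕ}
    (hr : ∀ i < I, r i ∈ V k n N₀) (h : ∀ i < I, g • y ^ i • f = r i • f) (N : ℕ) :
    I * Module.finrank K' (weylSpan k n K' (g • f) N) ≤
      Module.finrank K (weylSpan k n K f (N + N₀)) := by
  set v : (Fin (n + n) →₀ ℕ) → M := fun a => monomialWord k a • (g • f) with hv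
  set t := standardFinset K' v N with ht
  have hli : LinearIndependent K' (fun a : t => v a) :=
    linearIndepOn_standardExponents (K := K') v t fun a ha => (mem_standardFinset.mp ha).2
  have hpow : LinearIndependent K (fun i : Fin I => y ^ (i : ℕ)) := by
    have h1 := (Polynomial.basisMonomials K).linearIndependent.map' (Polynomial.aeval y).toLinearMap
      (LinearMap.ker_eq_bot.mpr (transcendental_iff_injective.mp hy))
    have h2 := h1.comp (fun i : Fin I => (i : ℕ)) Fin.val_injective
    simpa [Function.comp_def] using h2
  have hcomb := linearIndependent_smul hpow hli
  have hle : Submodule.span K (Set.range fun p : Fin I × t => y ^ (p.1 : ℕ) • v p.2) ≤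
      weylSpan k n K f (N + N₀) := by
    rw [Submodule.span_le]
    rintro _ ⟨⟨i, a⟩, rfl⟩
    have h1 : y ^ (i : ℕ) • v a = (monomialWord k (a : Fin (n + n) →₀ ℕ) * r i) • f := by
      rw [hv, mul_smul, ← h i i.2, smul_comm g, smul_comm (monomialWord k _)]
    have h2 : monomialWord k (a : Fin (n + n) →₀ ℕ) ∈ V k n N :=
      word_mem (by rw [length_monomialWord]; exact (mem_standardFinset.mp a.2).1)
    change y ^ (i : ℕ) • v a ∈ _
    rw [h1]
    exact smul_mem_weylSpan K f (mul_mem_V h2 (hr i i.2))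
  have hcard : Module.finrank K' (weylSpan k n K' (g • f) N) = t.card :=
    finrank_degreeSpan v N
  have h3 := Submodule.finrank_mono hle
  rw [finrank_span_eq_card hcomb, Fintype.card_prod, Fintype.card_fin, Fintype.card_coe] at h3
  rwa [hcard]

/-- Passing from a field `K'` of endomorphisms to a subfield `K` over which it is
transcendental raises the growth by at least one degree. -/
theorem GrowthAtLeast.of_transcendental [SMulCommClass (WeylAlgebra k n) K M] [CharZero k]
    (htf : ∀ (P : WeylAlgebra k n) (f : M), P ≠ 0 → f ≠ 0 → P • f ≠ 0)
    (hrank : ∀ f f' : M, f ≠ 0 → ∃ g r : WeylAlgebra k n, g ≠ 0 ∧ g • f' = r • f)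
    {y : K'} (hy : Transcendental K y) {d : ℕ} (hd : GrowthAtLeast k n M K' d) :
    GrowthAtLeast k n M K (d + 1) := by
  intro f hf
  rcases weylSpan_dichotomy (k := k) (n := n) K f d with h | ⟨C, hC⟩
  · exact h
  · exfalso
    set s := n + n + 1 with hs
    -- with this many powers of `y`, the upper bound given by `C` is violated at `N = N₀`
    set I := C * s ^ d + 1 with hI
    obtain ⟨g, r, hg, hgr⟩ := exists_common_multiplier hrank hf (fun i => y ^ i • f) I
    choose e he using fun i => exists_mem_V (r i)
    set N₀ := ∑ i ∈ Finset.range I, e i with hN₀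
    have hr : ∀ i < I, r i ∈ V k n N₀ := fun i hi =>
      V_mono (Finset.single_le_sum (f := e) (fun _ _ => Nat.zero_le _) (Finset.mem_range.mpr hi))
        (he i)
    have h1 := mul_finrank_weylSpan_le K K' hy hr hgr ((n + n) * N₀)
    have h2 := hd (g • f) (htf g f hg hf) N₀
    have h3 := ((Nat.mul_le_mul_left I h2).trans h1).trans (hC _)
    have h4 : ((n + n) * N₀ + N₀ + 1) ^ d ≤ s ^ d * (N₀ + 1) ^ d := by
      rw [← mul_pow]
      exact Nat.pow_le_pow_left (by nlinarith) d
    have h5 := h3.trans (Nat.mul_le_mul_left C h4)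
    rw [← mul_assoc] at h5
    have h6 := Nat.le_of_mul_le_mul_right h5 (by positivity)
    omega

end Jump

section Tower

variable {k : Type*} [Field k] {n : ℕ} {M : Type*} [AddCommGroup M]
  [Module (WeylAlgebra k n) M] [Module k M] [IsScalarTower k (WeylAlgebra k n) M]
  {L : Type*} [Field L] [Algebra k L] [Module L M] [IsScalarTower k L M]
  [SMulCommClass (WeylAlgebra k n) L M]

open scoped IntermediateField.algebraAdjoinAdjoin in
lemma transcendental_intermediateField_adjoin {ι : Type*} {y : ι → L}
    (hy : AlgebraicIndependent k y) {s : Set ι} {i : ι} (hi : i ∉ s) :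
    Transcendental (IntermediateField.adjoin k (y '' s)) (y i) := fun h =>
  hy.transcendental_adjoin hi ((IsFractionRing.isAlgebraic_iff _ _ _).mpr h)

lemma isScalarTower_intermediateField (F : IntermediateField k L) : IsScalarTower k F M :=
  ⟨fun c a m => by
    change (algebraMap F L (c • a)) • m = c • (algebraMap F L a • m)
    rw [← smul_assoc]
    rfl⟩

variable [CharZero k]

lemma growthAtLeast_intermediateField (F : IntermediateField k L) : GrowthAtLeast k n M F n := by
  have := isScalarTower_intermediateField (M := M) F
  have : CharZero F := charZero_of_injective_algebraMap (algebraMap k F).injective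
  exact growthAtLeast_bernstein F

lemma GrowthAtLeast.of_le
    (htf : ∀ (P : WeylAlgebra k n) (f : M), P ≠ 0 → f ≠ 0 → P • f ≠ 0)
    (hrank : ∀ f f' : M, f ≠ 0 → ∃ g r : WeylAlgebra k n, g ≠ 0 ∧ g • f' = r • f)
    {F F' : IntermediateField k L} (hle : F ≤ F') {y : L} (hy : y ∈ F') (htr : Transcendental F y)
    {d : ℕ} (hd : GrowthAtLeast k n M F' d) : GrowthAtLeast k n M F (d + 1) := by
  let : Algebra F F' := (IntermediateField.inclusion hle).toRingHom.toAlgebra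
  have : IsScalarTower F F' M := ⟨fun c a m => mul_smul (c : L) (a : L) m⟩
  have : IsScalarTower F F' L := ⟨fun c a m => mul_smul (c : L) (a : L) m⟩
  have := isScalarTower_intermediateField (M := M) F
  exact GrowthAtLeast.of_transcendental F F' htf hrank (y := ⟨y, hy⟩)
    ((transcendental_algebraMap_iff (algebraMap F' L).injective).mp htr) hd

lemma growthAtLeast_adjoin
    (htf : ∀ (P : WeylAlgebra k n) (f : M), P ≠ 0 → f ≠ 0 → P • f ≠ 0)
    (hrank : ∀ f f' : M, f ≠ 0 → ∃ g r : WeylAlgebra k n, g ≠ 0 ∧ g • f' = r • f)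
    {ι : Type*} {y : ι → L} (hy : AlgebraicIndependent k y) (S : Finset ι) :
    GrowthAtLeast k n M (IntermediateField.adjoin k (y '' (S : Set ι)ᶜ)) (n + S.card) := by
  classical
  induction S using Finset.induction_on with
  | empty =>
    rw [Finset.card_empty, add_zero]
    exact growthAtLeast_intermediateField _
  | insert i S hi ih =>
    rw [Finset.card_insert_of_notMem hi, ← add_assoc]
    have hmem : y i ∈ IntermediateField.adjoin k (y '' (S : Set ι)ᶜ) :=
      IntermediateField.subset_adjoin _ _ ⟨i, by simpa using hi, rfl⟩
    have htr : Transcendental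
        (IntermediateField.adjoin k (y '' ((insert i S : Finset ι) : Set ι)ᶜ)) (y i) :=
      transcendental_intermediateField_adjoin hy (by simp)
    refine GrowthAtLeast.of_le htf hrank ?_ hmem htr ih
    exact IntermediateField.adjoin.mono _ _ _
      (Set.image_mono (Set.compl_subset_compl.mpr (by simp)))

/-- A field of endomorphisms of a nonzero torsion-free module of rank one over the `n`-th Weyl
algebra has transcendence degree at most `n`. -/
theorem card_le_of_algebraicIndependent [Nontrivial M]
    (htf : ∀ (P : WeylAlgebra k n) (f : M), P ≠ 0 → f ≠ 0 → P • f ≠ 0)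
    (hrank : ∀ f f' : M, f ≠ 0 → ∃ g r : WeylAlgebra k n, g ≠ 0 ∧ g • f' = r • f)
    {ι : Type*} [Fintype ι] {y : ι → L} (hy : AlgebraicIndependent k y) :
    Fintype.card ι ≤ n := by
  obtain ⟨f, hf⟩ := exists_ne (0 : M)
  by_contra! hlt
  set s := n + n + 1 with hs
  have h1 := growthAtLeast_adjoin htf hrank hy Finset.univ f hf (s ^ (n + n))
  have h2 := h1.trans (finrank_weylSpan_le _ f _)
  set B := s ^ (n + n) with hB
  have h3 : ((n + n) * B + 1) ^ (n + n) ≤ s ^ (n + n) * (B + 1) ^ (n + n) := by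
    rw [← mul_pow]
    exact Nat.pow_le_pow_left (by nlinarith) _
  have h4 : (B + 1) ^ (n + n + 1) ≤ (B + 1) ^ (n + Finset.univ.card (α := ι)) :=
    Nat.pow_le_pow_right (by omega) (by rw [Finset.card_univ]; omega)
  have h5 := (h4.trans h2).trans h3
  rw [pow_succ', ← hB] at h5
  have h6 := Nat.le_of_mul_le_mul_right h5 (by positivity)
  omega

end Tower

end WeylAlgebra

/-! ### The Weyl field and its commutative subfields -/

namespace WeylField

open OreLocalization

section Basic

variable {k : Type*} [Field k] [CharZero k] {n : ℕ}

variable (k n) in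
/-- The inclusion of the Weyl algebra in its skew field of fractions. -/
noncomputable def ofAlgebra : WeylAlgebra k n →ₐ[k] WeylField k n where
  toRingHom := numeratorRingHom
  commutes' _ := rfl

lemma ofAlgebra_injective : Function.Injective (ofAlgebra k n) :=
  numeratorHom_inj (S := (WeylAlgebra k n)⁰) inf_le_left

lemma ofAlgebra_ne_zero {P : WeylAlgebra k n} (hP : P ≠ 0) : ofAlgebra k n P ≠ 0 :=
  (map_ne_zero_iff _ ofAlgebra_injective).mpr hP

lemma exists_ofAlgebra_mul_eq (f : WeylField k n) : ∃ s r : WeylAlgebra k n, s ≠ 0 ∧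
    ofAlgebra k n s * f = ofAlgebra k n r := by
  induction f using OreLocalization.ind with
  | _ r s =>
    refine ⟨s, r, nonZeroDivisors.coe_ne_zero s, ?_⟩
    change ((s : WeylAlgebra k n) /ₒ (1 : (WeylAlgebra k n)⁰)) * (r /ₒ s) = r /ₒ 1
    exact OreLocalization.mul_cancel

lemma ringHom_ext {D : Type*} [DivisionRing D] {φ ψ : WeylField k n →+* D}
    (h : ∀ P, φ (ofAlgebra k n P) = ψ (ofAlgebra k n P)) : φ = ψ := by
  ext f
  obtain ⟨s, r, hs, hf⟩ := exists_ofAlgebra_mul_eq f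
  have h1 := congrArg φ hf
  have h2 := congrArg ψ hf
  rw [map_mul] at h1 h2
  rw [h, h, ← h2] at h1
  exact mul_left_cancel₀ ((map_ne_zero ψ).mpr (ofAlgebra_ne_zero hs)) h1

end Basic

section TranscendenceDegree

variable {k : Type*} [Field k] [CharZero k] {n : ℕ}

/-- Subfields of the Weyl field have transcendence degree at most `n`: by right multiplication
they commute with the left action of the Weyl algebra. -/
theorem card_le_of_field {L : Type*} [Field L] [Algebra k L] (φ : L →ₐ[k] WeylField k n)
    {ι : Type*} [Fintype ι] {y : ι → L} (hy : AlgebraicIndependent k y) :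
    Fintype.card ι ≤ n := by
  let _ : Module L (WeylField k n) :=
    Module.compHom _ (φ.toRingHom.toOpposite fun a b => by
      change φ a * φ b = φ b * φ a
      rw [← map_mul, mul_comm, map_mul])
  have hA : ∀ (P : WeylAlgebra k n) (f : WeylField k n), P • f = ofAlgebra k n P * f :=
    fun P f => (oreDiv_one_smul P f).symm
  have hL : ∀ (a : L) (f : WeylField k n), a • f = f * φ a := fun _ _ => rfl
  have : IsScalarTower k (WeylAlgebra k n) (WeylField k n) :=
    ⟨fun c P f => by rw [hA, hA, map_smul, smul_mul_assoc]⟩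
  have : IsScalarTower k L (WeylField k n) :=
    ⟨fun c a f => by rw [hL, hL, map_smul, mul_smul_comm]⟩
  have : SMulCommClass (WeylAlgebra k n) L (WeylField k n) :=
    ⟨fun P a f => by rw [hA, hA, hL, hL, mul_assoc]⟩
  refine WeylAlgebra.card_le_of_algebraicIndependent (M := WeylField k n) (L := L)
    (fun P f hP hf => ?_) (fun f f' hf => ?_) hy
  · rw [hA]
    exact mul_ne_zero (ofAlgebra_ne_zero hP) hf
  · obtain ⟨s, r, hs, h⟩ := exists_ofAlgebra_mul_eq (f' * f⁻¹)
    refine ⟨s, r, hs, ?_⟩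
    rw [hA, hA, ← h, mul_assoc, mul_assoc, inv_mul_cancel₀ hf, mul_one]

theorem card_le_of_mvPolynomial {ι : Type*} [Fintype ι] (φ : MvPolynomial ι k →ₐ[k] WeylField k n)
    (hφ : Function.Injective φ) : Fintype.card ι ≤ n := by
  have hne : ∀ p : (MvPolynomial ι k)⁰, φ p ≠ 0 := fun p =>
    (map_ne_zero_iff φ hφ).mpr (nonZeroDivisors.coe_ne_zero p)
  let u : (MvPolynomial ι k)⁰ →* (WeylField k n)ˣ :=
    { toFun := fun p => Units.mk0 (φ p) (hne p)
      map_one' := Units.ext (by simp)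
      map_mul' := fun p q => Units.ext (by simp) }
  let ψ : FractionRing (MvPolynomial ι k) →+* WeylField k n :=
    universalHom φ.toRingHom u fun _ => rfl
  have hψ : ∀ p, ψ (algebraMap (MvPolynomial ι k) _ p) = φ p := fun p =>
    universalHom_commutes _ _ _
  let Ψ : FractionRing (MvPolynomial ι k) →ₐ[k] WeylField k n :=
    { ψ with
      commutes' := fun c => by
        change ψ (algebraMap k (FractionRing (MvPolynomial ι k)) c) = _
        rw [IsScalarTower.algebraMap_apply k (MvPolynomial ι k), hψ, AlgHom.commutes] }
  have hX : AlgebraicIndependent k (fun i : ι =>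
      algebraMap (MvPolynomial ι k) (FractionRing (MvPolynomial ι k)) (MvPolynomial.X i)) :=
    (MvPolynomial.algebraicIndependent_X ι k).map' (f := IsScalarTower.toAlgHom k _ _)
      (IsFractionRing.injective _ _)
  exact card_le_of_field Ψ hX

end TranscendenceDegree

end WeylField

/-! ### Inner automorphisms and the centre of the Weyl field -/

namespace WeylAlgebra

variable {k : Type*} [Field k] {n : ℕ}

lemma ad_pow_ad (a b : Fin n ⊕ Fin n) (p : ℕ) (P : WeylAlgebra k n) :
    (ad k b ^ p) (ad k a P) = ad k a ((ad k b ^ p) P) := by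
  induction p with
  | zero => simp
  | succ p ih => rw [pow_succ', Module.End.mul_apply, ih, ad_ad, Module.End.mul_apply]

variable [CharZero k]

/-- A nonzero subspace stable under the inner derivations contains `1`; in particular the Weyl
algebra is simple. -/
lemma one_mem_of_ad_mem (J : Submodule k (WeylAlgebra k n)) (hJ : ∀ a, ∀ P ∈ J, ad k a P ∈ J)
    {P : WeylAlgebra k n} (hP : P ∈ J) (hP0 : P ≠ 0) : 1 ∈ J := by
  classical
  have hpow : ∀ a p, ∀ P ∈ J, (ad k a ^ p) P ∈ J := by
    intro a p
    induction p with
    | zero => exact fun P hP => by simpa using hP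
    | succ p ih =>
      intro P hP
      rw [pow_succ', Module.End.mul_apply]
      exact hJ a _ (ih P hP)
  have key : ∀ S : Finset (Fin n ⊕ Fin n), ∃ Q ∈ J, Q ≠ 0 ∧ ∀ a ∈ S, ad k a Q = 0 := by
    intro S
    induction S using Finset.induction_on with
    | empty => exact ⟨P, hP, hP0, by simp⟩
    | insert a S _ ih =>
      obtain ⟨Q, hQ, hQ0, hS⟩ := ih
      obtain ⟨p, hp, hp2⟩ := exists_ad_pow a hQ0
      refine ⟨_, hpow a p Q hQ, hp, fun b hb => ?_⟩
      rcases Finset.mem_insert.mp hb with rfl | hb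
      · rwa [pow_succ', Module.End.mul_apply] at hp2
      · exact ad_ad_pow a b p (hS b hb)
  obtain ⟨Q, hQ, hQ0, hS⟩ := key Finset.univ
  obtain ⟨c, rfl⟩ := exists_algebraMap_eq
    (mem_V_zero_of_central fun a => hS a (Finset.mem_univ a))
  have hc : c ≠ 0 := fun h => hQ0 (by rw [h, map_zero])
  have h1 := J.smul_mem c⁻¹ hQ
  rwa [Algebra.algebraMap_eq_smul_one, smul_smul, inv_mul_cancel₀ hc, one_smul] at h1

/-- If `[∂, U] = w U` for a generator `∂`, then `w = 0`: the degree of nilpotency of the inner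
derivation of each generator is additive on products, which forces `w` to be a scalar, and this
scalar is an eigenvalue of a locally nilpotent operator. -/
lemma eq_zero_of_ad_eq_mul {a : Fin n ⊕ Fin n} {U w : WeylAlgebra k n} (hU : U ≠ 0)
    (h : ad k a U = w * U) : w = 0 := by
  by_contra hw
  have hcentral : ∀ b, ad k b w = 0 := by
    intro b
    obtain ⟨p, hp, hp2⟩ := exists_ad_pow b hw
    obtain ⟨q, hq, hq2⟩ := exists_ad_pow b hU
    rcases Nat.eq_zero_or_pos p with rfl | hpos
    · simpa using hp2
    · exfalso
      have h1 := ad_pow_mul b p q w U hp2 hq2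
      have h2 : (ad k b ^ (p + q)) U = 0 := by
        rw [show p + q = (p - 1) + (q + 1) by omega, pow_add, Module.End.mul_apply, hq2, map_zero]
      rw [← h, ad_pow_ad, h2, map_zero, ← Nat.cast_smul_eq_nsmul k] at h1
      rcases smul_eq_zero.mp h1.symm with h3 | h3
      · exact (Nat.choose_pos (Nat.le_add_right p q)).ne' (by exact_mod_cast h3)
      · exact mul_ne_zero hp hq h3
  obtain ⟨c, rfl⟩ := exists_algebraMap_eq (mem_V_zero_of_central hcentral)
  rw [← Algebra.smul_def] at h
  have hpow : ∀ p, (ad k a ^ p) U = c ^ p • U := by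
    intro p
    induction p with
    | zero => simp
    | succ p ih => rw [pow_succ', Module.End.mul_apply, ih, map_smul, h, smul_smul, pow_succ]
  obtain ⟨e, he⟩ := exists_mem_V U
  have h1 := ad_pow_eq_zero a he
  rw [hpow] at h1
  have hc := eq_zero_of_pow_eq_zero ((smul_eq_zero.mp h1).resolve_right hU)
  exact hw (by rw [hc, map_zero])

end WeylAlgebra

namespace WeylField

variable {k : Type*} [Field k] [CharZero k] {n : ℕ}

/-- An element of the Weyl field inducing a surjective endomorphism of the Weyl algebra by
conjugation lies in the Weyl algebra. -/
lemma exists_eq_ofAlgebra {α : WeylAlgebra k n →ₐ[k] WeylAlgebra k n} (hα : Function.Surjective α)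
    {u : WeylField k n}
    (h : ∀ P, u * ofAlgebra k n P = ofAlgebra k n (α P) * u) : ∃ U, ofAlgebra k n U = u := by
  let J : Submodule k (WeylAlgebra k n) :=
    (LinearMap.range (ofAlgebra k n).toLinearMap).comap
      (LinearMap.mulRight k u ∘ₗ (ofAlgebra k n).toLinearMap)
  have hJ : ∀ P, P ∈ J ↔ ∃ Q, ofAlgebra k n Q = ofAlgebra k n P * u := fun P => Iff.rfl
  obtain ⟨s, r, hs, hr⟩ := exists_ofAlgebra_mul_eq u
  have h1 := WeylAlgebra.one_mem_of_ad_mem J (fun a P hP => ?_) ((hJ s).mpr ⟨r, hr.symm⟩) hs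
  · obtain ⟨U, hU⟩ := (hJ 1).mp h1
    exact ⟨U, by rw [hU, map_one, one_mul]⟩
  · obtain ⟨Q, hQ⟩ := (hJ P).mp hP
    obtain ⟨b, hb⟩ := hα (WeylAlgebra.gen k a)
    refine (hJ _).mpr ⟨WeylAlgebra.gen k a * Q - Q * b, ?_⟩
    rw [WeylAlgebra.ad_apply, map_sub, map_sub, map_mul, map_mul, map_mul, map_mul, sub_mul, hQ,
      mul_assoc, mul_assoc, mul_assoc, h b, hb]

lemma exists_algebraMap_eq_of_commute {z : WeylField k n}
    (h : ∀ P, z * ofAlgebra k n P = ofAlgebra k n P * z) :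
    ∃ c : k, algebraMap k (WeylField k n) c = z := by
  obtain ⟨Z, rfl⟩ := exists_eq_ofAlgebra (α := AlgHom.id k _) Function.surjective_id h
  obtain ⟨c, rfl⟩ := WeylAlgebra.exists_algebraMap_eq
    (WeylAlgebra.mem_V_zero_of_central (P := Z) fun a => ofAlgebra_injective (by
      rw [WeylAlgebra.ad_apply, map_sub, map_mul, map_mul, h, sub_self, map_zero]))
  exact ⟨c, (AlgHom.commutes _ c).symm⟩

/-- An inner automorphism of the Weyl field which preserves the Weyl algebra is trivial. -/
lemma eq_id_of_inner {α : WeylAlgebra k n →ₐ[k] WeylAlgebra k n} (hα : Function.Surjective α)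
    {u : WeylField k n} (hu : u ≠ 0)
    (h : ∀ P, u * ofAlgebra k n P = ofAlgebra k n (α P) * u) : α = AlgHom.id k _ := by
  obtain ⟨U, rfl⟩ := exists_eq_ofAlgebra hα h
  have hU : U ≠ 0 := fun h0 => hu (by rw [h0, map_zero])
  have hgen : ∀ a, α (WeylAlgebra.gen k a) = WeylAlgebra.gen k a := by
    intro a
    have h1 : U * WeylAlgebra.gen k a = α (WeylAlgebra.gen k a) * U :=
      ofAlgebra_injective (by rw [map_mul, map_mul, h])
    refine (sub_eq_zero.mp (WeylAlgebra.eq_zero_of_ad_eq_mul (a := a) hU ?_)).symm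
    rw [WeylAlgebra.ad_apply, h1, sub_mul]
  exact WeylAlgebra.algHom_ext (fun i => hgen _) (fun i => hgen _)

end WeylField

/-! ### Centralizers of rings of invariants of outer automorphisms -/

section Outer

variable {F : Type*} [DivisionRing F]

/-- Artin's argument: a relation of minimal length between ring automorphisms, with coefficients
on the left, only involves automorphisms which agree up to inner ones. -/
lemma exists_minimal_relation {I : Type*} [Fintype I] (τ : I → F ≃+* F) {a : I → F} (ha : a ≠ 0)
    (h : ∀ f, ∑ i, a i * τ i f = 0) :
    ∃ b : I → F, b ≠ 0 ∧ (∀ f, ∑ i, b i * τ i f = 0) ∧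
      ∃ i₀, ∀ j p, b j * τ j p = τ i₀ p * b j := by
  classical
  obtain ⟨b, ⟨hb0, hb⟩, hmin⟩ := exists_minimalFor_of_wellFoundedLT
    (fun b : I → F => b ≠ 0 ∧ ∀ f, ∑ i, b i * τ i f = 0)
    (fun b => (Finset.univ.filter fun i => b i ≠ 0).card) ⟨a, ha, h⟩
  obtain ⟨i₀, hi₀⟩ := Function.ne_iff.mp hb0
  refine ⟨fun i => (b i₀)⁻¹ * b i, Function.ne_iff.mpr ⟨i₀, mul_ne_zero (inv_ne_zero hi₀) hi₀⟩,
    fun f => ?_, i₀, ?_⟩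
  · simp only [mul_assoc, ← Finset.mul_sum, hb, mul_zero]
  · by_contra! hne
    obtain ⟨j, p, hjp⟩ := hne
    -- a shorter relation, obtained by replacing `f` with `p * f`; its coefficient at `i₀` is zero
    set c : I → F := fun i => (b i₀)⁻¹ * b i * τ i p - τ i₀ p * ((b i₀)⁻¹ * b i) with hc
    have hc0 : c ≠ 0 := Function.ne_iff.mpr ⟨j, sub_ne_zero.mpr hjp⟩
    have hcrel : ∀ f, ∑ i, c i * τ i f = 0 := by
      intro f
      have h1 : ∀ i, c i * τ i f =
          (b i₀)⁻¹ * (b i * τ i (p * f)) - τ i₀ p * ((b i₀)⁻¹ * (b i * τ i f)) := fun i => by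
        simp only [hc, map_mul, sub_mul, mul_assoc]
      simp only [h1, Finset.sum_sub_distrib, ← Finset.mul_sum, hb, mul_zero, sub_zero]
    have hsub : (Finset.univ.filter fun i => c i ≠ 0) ⊂ Finset.univ.filter fun i => b i ≠ 0 := by
      refine Finset.ssubset_iff_of_subset (fun i hi => ?_) |>.mpr ⟨i₀, ?_, ?_⟩
      · rw [Finset.mem_filter] at hi ⊢
        refine ⟨hi.1, fun h0 => hi.2 ?_⟩
        simp [hc, h0]
      · simpa using hi₀
      · simp [hc, inv_mul_cancel₀ (show b i₀ ≠ 0 from hi₀)]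
    exact absurd (hmin ⟨hc0, hcrel⟩ (Finset.card_lt_card hsub).le)
      (not_le.mpr (Finset.card_lt_card hsub))

/-- An element commuting with the invariants of a finite group of outer automorphisms of a skew
field is central: conjugation by it preserves the trace, and this is a relation between
automorphisms. -/
theorem commute_of_commute_invariants (Γ : Subgroup (F ≃+* F)) [Finite Γ]
    (hout : ∀ σ ∈ Γ, ∀ u : F, u ≠ 0 → (∀ f, u * f = σ f * u) → σ = 1) {z : F}
    (hz : ∀ f, (∀ σ ∈ Γ, σ f = f) → z * f = f * z) (f : F) : z * f = f * z := by
  classical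
  have := Fintype.ofFinite Γ
  rcases eq_or_ne z 0 with rfl | hz0
  · simp
  -- the automorphism `σ` is paired with its composition with the conjugation by `z`
  let e : Bool → Fˣ := fun b => if b then Units.mk0 z hz0 else 1
  let conj : Fˣ → F ≃+* F := fun u =>
    { toFun := fun f => u * f * (u⁻¹ : Fˣ)
      invFun := fun f => (u⁻¹ : Fˣ) * f * u
      left_inv := fun f => by simp [mul_assoc]
      right_inv := fun f => by simp [mul_assoc]
      map_mul' := fun f g => by simp [mul_assoc]
      map_add' := fun f g => by simp [mul_add, add_mul] }
  let τ : Γ × Bool → F ≃+* F := fun i => (i.1 : F ≃+* F).trans (conj (e i.2))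
  have hτ : ∀ i f, τ i f = e i.2 * (i.1 : F ≃+* F) f * ((e i.2)⁻¹ : Fˣ) := fun _ _ => rfl
  -- conjugation by `z` fixes the trace of `f`, which is invariant under `Γ`
  have hrel : ∀ f, ∑ i : Γ × Bool, (if i.2 then 1 else -1 : F) * τ i f = 0 := by
    intro f
    have h1 : ∀ σ ∈ Γ, σ (∑ ρ : Γ, (ρ : F ≃+* F) f) = ∑ ρ : Γ, (ρ : F ≃+* F) f := by
      intro σ hσ
      rw [map_sum]
      exact Fintype.sum_equiv (Equiv.mulLeft ⟨σ, hσ⟩) _ _ fun ρ => rfl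
    have h2 := hz _ h1
    have h3 : z * (∑ ρ : Γ, (ρ : F ≃+* F) f) * z⁻¹ = ∑ ρ : Γ, (ρ : F ≃+* F) f := by
      rw [h2, mul_assoc, mul_inv_cancel₀ hz0, mul_one]
    rw [Fintype.sum_prod_type]
    simp only [hτ, Fintype.sum_bool, e, if_true, Bool.false_eq_true, if_false, one_mul, inv_one,
      Units.val_one, mul_one, Units.val_inv_eq_inv_val, Units.val_mk0, neg_mul,
      Finset.sum_add_distrib, Finset.sum_neg_distrib]
    rw [← Finset.sum_mul, ← Finset.mul_sum, h3, add_neg_cancel]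
  obtain ⟨b, hb0, hb, ⟨σ, ε⟩, hcomm⟩ := exists_minimal_relation τ
    (Function.ne_iff.mpr ⟨(1, true), by simp⟩) hrel
  -- only the two automorphisms attached to `σ` can occur, because `Γ` is outer
  have hsupp : ∀ σ' ε', b (σ', ε') ≠ 0 → σ' = σ := by
    intro σ' ε' hne
    have h1 := hout ((σ : F ≃+* F) * (σ' : F ≃+* F)⁻¹) (Γ.mul_mem σ.2 (Γ.inv_mem σ'.2))
      (((e ε)⁻¹ : Fˣ) * b (σ', ε') * e ε')
      (mul_ne_zero (mul_ne_zero (Units.ne_zero _) hne) (Units.ne_zero _)) fun f => ?_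
    · exact (Subtype.ext (mul_inv_eq_one.mp h1)).symm
    · have h2 := hcomm (σ', ε') ((σ' : F ≃+* F)⁻¹ f)
      have h3 : (σ' : F ≃+* F) ((σ' : F ≃+* F)⁻¹ f) = f := (σ' : F ≃+* F).apply_symm_apply f
      simp only [hτ, h3] at h2
      have h4 := congrArg (fun t => ((e ε)⁻¹ : Fˣ) * t * (e ε' : F)) h2
      simp only [← mul_assoc, Units.inv_mul, one_mul] at h4
      simp only [mul_assoc, Units.inv_mul, mul_one] at h4
      simp only [mul_assoc]
      exact h4
  have hrel2 : ∀ f, b (σ, true) * (z * σ.1 f * z⁻¹) + b (σ, false) * σ.1 f = 0 := by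
    intro f
    have h1 := hb f
    rw [Fintype.sum_prod_type, Finset.sum_eq_single σ] at h1
    · simpa [hτ, e] using h1
    · intro σ' _ hne
      have h0 : ∀ ε', b (σ', ε') = 0 := fun ε' => by
        by_contra h0
        exact hne (hsupp σ' ε' h0)
      simp [h0]
    · simp
  have hsum : b (σ, false) = - b (σ, true) := by
    have h1 := hrel2 1
    rw [map_one, mul_one, mul_one, mul_inv_cancel₀ hz0, mul_one] at h1
    exact eq_neg_of_add_eq_zero_right h1
  have hne : b (σ, true) ≠ 0 := by
    intro h0
    refine hb0 (funext fun i => ?_)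
    by_contra hi
    obtain ⟨σ', ε'⟩ := i
    obtain rfl := hsupp σ' ε' hi
    cases ε'
    · exact hi (by rw [hsum, h0, neg_zero]; rfl)
    · exact hi h0
  have h1 := hrel2 ((σ : F ≃+* F)⁻¹ f)
  have h3 : σ.1 ((σ : F ≃+* F)⁻¹ f) = f := (σ : F ≃+* F).apply_symm_apply f
  rw [h3, hsum, neg_mul, ← sub_eq_add_neg, ← mul_sub] at h1
  exact (mul_inv_eq_iff_eq_mul₀ hz0).mp (sub_eq_zero.mp ((mul_eq_zero.mp h1).resolve_left hne))

end Outer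

/-! ### Invariants of linear actions -/

namespace WeylAlgebra

variable {k : Type*} [Field k] {n : ℕ}

variable (k n) in
open scoped IsMulCommutative in
/-- The inclusion of the commutative polynomial ring in the Weyl algebra. -/
noncomputable def ofPolynomial : MvPolynomial (Fin n) k →ₐ[k] WeylAlgebra k n :=
  have := Algebra.isMulCommutative_adjoin k (s := Set.range (x k (n := n))) (by
    rintro _ ⟨i, rfl⟩ _ ⟨j, rfl⟩
    exact x_mul_x i j)
  (Algebra.adjoin k (Set.range (x k (n := n)))).val.comp
    (MvPolynomial.aeval (S₁ := Algebra.adjoin k (Set.range (x k (n := n))))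
      fun i => ⟨x k i, Algebra.subset_adjoin ⟨i, rfl⟩⟩)

lemma ofPolynomial_X (i : Fin n) : ofPolynomial k n (MvPolynomial.X i) = x k i := by
  simp [ofPolynomial]

variable (k n) in
/-- The action of the Weyl algebra on polynomials by differential operators. -/
noncomputable def polynomialRep : WeylAlgebra k n →ₐ[k] Module.End k (MvPolynomial (Fin n) k) :=
  lift (fun i => LinearMap.mulLeft k (MvPolynomial.X i : MvPolynomial (Fin n) k))
    (fun i => (MvPolynomial.pderiv (R := k) i).toLinearMap)
    (fun i j => LinearMap.ext fun p => by simp [mul_left_comm])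
    (fun i j => by
      refine LinearMap.ext fun p => ?_
      have h : ⁅MvPolynomial.pderiv (R := k) i, MvPolynomial.pderiv (R := k) j⁆ = 0 := by
        apply MvPolynomial.derivation_ext
        intro l
        simp [Derivation.commutator_apply, MvPolynomial.pderiv_X, Pi.single_apply, apply_ite]
      have h2 := congrArg (fun D => D p) h
      simp only [Derivation.commutator_apply, Derivation.zero_apply, sub_eq_zero] at h2
      exact h2)
    (fun i j => by
      refine LinearMap.ext fun p => ?_
      by_cases hij : i = j
      · subst hij
        simp [MvPolynomial.pderiv_X]
      · simp [hij, MvPolynomial.pderiv_X, Ne.symm hij])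

lemma ofPolynomial_injective : Function.Injective (ofPolynomial k n) := by
  have h : (polynomialRep k n).comp (ofPolynomial k n) = Algebra.lmul k _ :=
    MvPolynomial.algHom_ext fun i => by
      rw [AlgHom.comp_apply, ofPolynomial_X]
      exact lift_x _ _ _ _ _ i
  intro p q hpq
  have h1 := congrArg (fun P => polynomialRep k n P 1) hpq
  have h2 : ∀ p, polynomialRep k n (ofPolynomial k n p) 1 = p := fun p => by
    have := congrArg (fun φ => φ p 1) h
    simpa using this
  simpa [h2] using h1

/-- The linear substitution of the variables of a polynomial ring by an invertible matrix. -/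
noncomputable def substitution (M : GL (Fin n) k) :
    MvPolynomial (Fin n) k →ₐ[k] MvPolynomial (Fin n) k :=
  MvPolynomial.aeval fun j => ∑ i, (M : Matrix (Fin n) (Fin n) k) i j • MvPolynomial.X i

lemma ofPolynomial_substitution (M : GL (Fin n) k) (p : MvPolynomial (Fin n) k) :
    ofPolynomial k n (substitution M p) = act M (ofPolynomial k n p) := by
  have h : (ofPolynomial k n).comp (substitution M) = (act M).comp (ofPolynomial k n) :=
    MvPolynomial.algHom_ext fun j => by
      rw [AlgHom.comp_apply, AlgHom.comp_apply, ofPolynomial_X, act_x, substitution,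
        MvPolynomial.aeval_X, map_sum]
      simp only [map_smul, ofPolynomial_X]
  exact congrArg (fun φ => φ p) h

lemma act_surjective (M : GL (Fin n) k) : Function.Surjective (act M) := fun P =>
  ⟨act M⁻¹ P, by rw [← AlgHom.comp_apply, ← act_mul, mul_inv_cancel, act_one, AlgHom.id_apply]⟩

/-- The polynomial ring has `n` algebraically independent elements invariant under a finite
linear group, since it is integral over the subring of invariants. -/
lemma exists_algebraicIndependent_invariants {G : Type*} [Group G] [Finite G]
    (ρ : G →* GL (Fin n) k) : ∃ y : Fin n → MvPolynomial (Fin n) k, AlgebraicIndependent k y ∧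
      ∀ i g, substitution (ρ g) (y i) = y i := by
  let R := MvPolynomial (Fin n) k
  let action : MulSemiringAction G R :=
    { smul := fun g p => substitution (ρ g) p
      one_smul := fun p => ofPolynomial_injective (by
        change ofPolynomial k n (substitution (ρ 1) p) = _
        rw [ofPolynomial_substitution, map_one, act_one, AlgHom.id_apply])
      mul_smul := fun g h p => ofPolynomial_injective (by
        change ofPolynomial k n (substitution (ρ (g * h)) p) =
          ofPolynomial k n (substitution (ρ g) (substitution (ρ h) p))
        simp only [ofPolynomial_substitution, map_mul, act_mul, AlgHom.comp_apply])
      smul_zero := fun g => map_zero (substitution (ρ g))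
      smul_add := fun g => map_add (substitution (ρ g))
      smul_one := fun g => map_one (substitution (ρ g))
      smul_mul := fun g => map_mul (substitution (ρ g)) }
  let S : Subalgebra k R :=
    { carrier := {p | ∀ g, substitution (ρ g) p = p}
      mul_mem' := fun ha hb g => by rw [map_mul, ha g, hb g]
      add_mem' := fun ha hb g => by rw [map_add, ha g, hb g]
      algebraMap_mem' := fun c g => AlgHom.commutes _ c }
  have : SMulCommClass G S R := ⟨fun g s p => by
    change substitution (ρ g) ((s : R) * p) = s * substitution (ρ g) p
    rw [map_mul, s.2 g]⟩
  have : Algebra.IsInvariant S R G := ⟨fun p hp => ⟨⟨p, hp⟩, rfl⟩⟩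
  have hint : Algebra.IsIntegral S R := Algebra.IsInvariant.isIntegral S R G
  have hS : Algebra.adjoin k (S : Set R) = S := Algebra.adjoin_eq S
  have : Algebra.IsAlgebraic (Algebra.adjoin k (S : Set R)) R := by
    rw [hS]
    infer_instance
  obtain ⟨t, htS, ht⟩ := exists_isTranscendenceBasis_subset (R := k) (S : Set R)
  have hcard := IsTranscendenceBasis.lift_cardinalMk_eq ht
    (IsTranscendenceBasis.mvPolynomial (Fin n) k)
  rw [Cardinal.lift_id', Cardinal.mk_fin, Cardinal.lift_natCast] at hcard
  obtain ⟨e⟩ : Nonempty (Fin n ≃ t) := by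
    rw [← Cardinal.lift_mk_eq']
    simp [hcard]
  exact ⟨fun i => e i, ht.1.comp e e.injective, fun i => htS (e i).2⟩

end WeylAlgebra

namespace WeylField

variable {k : Type*} [Field k] [CharZero k] {n : ℕ} {G : Type*} [Group G]

lemma act_ofAlgebra (M : GL (Fin n) k) (P : WeylAlgebra k n) :
    act M (ofAlgebra k n P) = ofAlgebra k n (WeylAlgebra.act M P) :=
  act_numerator M P

lemma ofPolynomial_mem_invariants (ρ : G →* GL (Fin n) k) {p : MvPolynomial (Fin n) k}
    (hp : ∀ g, WeylAlgebra.substitution (ρ g) p = p) :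
    ofAlgebra k n (WeylAlgebra.ofPolynomial k n p) ∈ invariants ρ := fun g => by
  rw [act_ofAlgebra, ← WeylAlgebra.ofPolynomial_substitution, hp]

lemma act_one : act (1 : GL (Fin n) k) = RingHom.id _ :=
  ringHom_ext fun P => by rw [act_ofAlgebra, WeylAlgebra.act_one]; rfl

lemma act_mul (M N : GL (Fin n) k) : act (M * N) = (act M).comp (act N) :=
  ringHom_ext fun P => by
    rw [RingHom.comp_apply]
    simp only [act_ofAlgebra, WeylAlgebra.act_mul, AlgHom.comp_apply]

/-- The linear action of `GL_n(k)` on the Weyl field by ring automorphisms. -/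
noncomputable def actAut : GL (Fin n) k →* (WeylField k n ≃+* WeylField k n) where
  toFun M := RingEquiv.ofRingHom (act M) (act M⁻¹)
    (by rw [← act_mul, mul_inv_cancel, act_one]) (by rw [← act_mul, inv_mul_cancel, act_one])
  map_one' := RingEquiv.ext fun f => by
    change act 1 f = f
    rw [act_one, RingHom.id_apply]
  map_mul' M N := RingEquiv.ext fun f => by
    change act (M * N) f = act M (act N f)
    rw [act_mul, RingHom.comp_apply]

/-- The centralizer of the skew field of invariants is the field of scalars. -/
theorem exists_algebraMap_eq_of_commute_invariants [Finite G] (ρ : G →* GL (Fin n) k)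
    {z : WeylField k n} (hz : ∀ f ∈ invariants ρ, z * f = f * z) :
    ∃ c : k, algebraMap k (WeylField k n) c = z := by
  have : Finite (actAut.comp ρ).range := Set.finite_range _
  refine exists_algebraMap_eq_of_commute fun P => ?_
  refine commute_of_commute_invariants (actAut.comp ρ).range ?_
    (fun f hf => hz f fun g => hf _ ⟨g, rfl⟩) _
  rintro _ ⟨g, rfl⟩ u hu h
  have h1 : WeylAlgebra.act (ρ g) = AlgHom.id k _ :=
    eq_id_of_inner (WeylAlgebra.act_surjective _) hu fun P => by
      rw [← act_ofAlgebra]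
      exact h _
  have h2 : act (ρ g) = RingHom.id _ := ringHom_ext fun P => by
    rw [act_ofAlgebra, h1]
    rfl
  exact RingEquiv.ext fun f => congrArg (fun φ => φ f) h2

end WeylField

theorem mainTheorem8 {k : Type*} [Field k] [CharZero k] {G : Type*} [Group G] [Finite G]
    (n : ℕ) (ρ : G →* GL (Fin n) k)
    (m : ℕ) {L : Type*} [Field L] [CharZero L] [Algebra k L] (hL : IsPurelyTranscendental k L)
    (t : Cardinal) (ht : Algebra.trdeg k L = t)
    (hiso : Nonempty (WeylField.invariants ρ ≃ₐ[k] WeylField L m)) :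
    m = n ∧ t = 0 := by
  obtain ⟨e⟩ := hiso
  have htower : ∀ c : k, algebraMap k (WeylField L m) c =
      algebraMap L (WeylField L m) (algebraMap k L c) := fun c =>
    IsScalarTower.algebraMap_apply k L (WeylField L m) c
  have hsurj : Function.Surjective (algebraMap k L) := by
    intro l
    obtain ⟨c, hc⟩ := WeylField.exists_algebraMap_eq_of_commute_invariants ρ
      (z := e.symm (algebraMap L (WeylField L m) l)) fun f hf => by
        have h := congrArg e.symm (Algebra.commutes l (e ⟨f, hf⟩))
        rw [map_mul, map_mul, AlgEquiv.symm_apply_apply] at h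
        exact congrArg Subtype.val h
    refine ⟨c, (algebraMap L (WeylField L m)).injective ?_⟩
    have h : algebraMap k (WeylField.invariants ρ) c = e.symm (algebraMap L (WeylField L m) l) :=
      Subtype.ext hc
    rw [← htower, ← AlgEquiv.commutes e, h, AlgEquiv.apply_symm_apply]
  have halg : Algebra.IsAlgebraic k L := ⟨fun l => by
    obtain ⟨c, rfl⟩ := hsurj l
    exact isAlgebraic_algebraMap c⟩
  refine ⟨le_antisymm ?_ ?_, ht ▸ trdeg_eq_zero⟩
  · -- the images of `x_1, …, x_m` in the Weyl field `F_n(k)` commute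
    let ι := MvPolynomial.mapAlgHom (σ := Fin m) (Algebra.ofId k L)
    let φ : MvPolynomial (Fin m) k →ₐ[k] WeylField k n :=
      (WeylField.invariants ρ).val.comp (e.symm.toAlgHom.comp
        ((((WeylField.ofAlgebra L m).comp
          (WeylAlgebra.ofPolynomial L m)).restrictScalars k).comp ι))
    have hφ : Function.Injective φ :=
      Subtype.val_injective.comp (e.symm.injective.comp
        ((WeylField.ofAlgebra_injective.comp WeylAlgebra.ofPolynomial_injective).comp
          (MvPolynomial.map_injective _ (algebraMap k L).injective)))
    simpa using WeylField.card_le_of_mvPolynomial φ hφ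
  · -- invariant polynomials give `n` commuting elements of `F_m(L)`, and `L` is `k`
    obtain ⟨y, hy, hinv⟩ := WeylAlgebra.exists_algebraicIndependent_invariants ρ
    let κ : k ≃+* L := RingEquiv.ofBijective (algebraMap k L) ⟨(algebraMap k L).injective, hsurj⟩
    let u : MvPolynomial (Fin n) k →ₐ[k] WeylField k n :=
      (WeylField.ofAlgebra k n).comp ((WeylAlgebra.ofPolynomial k n).comp (MvPolynomial.aeval y))
    have hu : ∀ p, u p ∈ WeylField.invariants ρ := by
      intro p
      refine WeylField.ofPolynomial_mem_invariants ρ fun g => ?_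
      have hfix : (WeylAlgebra.substitution (ρ g)).comp (MvPolynomial.aeval y) =
          MvPolynomial.aeval y := MvPolynomial.algHom_ext fun i => by simp [hinv]
      exact DFunLike.congr_fun hfix p
    let v : MvPolynomial (Fin n) k →ₐ[k] WeylField L m :=
      e.toAlgHom.comp (u.codRestrict _ hu)
    let φ : MvPolynomial (Fin n) L →ₐ[L] WeylField L m :=
      { v.toRingHom.comp (MvPolynomial.mapEquiv (Fin n) κ.symm).toRingHom with
        commutes' := fun l => by
          obtain ⟨c, rfl⟩ := hsurj l
          change v (MvPolynomial.map (κ.symm : L →+* k) (MvPolynomial.C (κ c))) = _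
          rw [MvPolynomial.map_C, ← htower, ← AlgHom.commutes v]
          exact congrArg (fun a => v (MvPolynomial.C a)) (κ.symm_apply_apply c) }
    have huinj : Function.Injective u :=
      WeylField.ofAlgebra_injective.comp (WeylAlgebra.ofPolynomial_injective.comp hy)
    have hφ : Function.Injective φ := by
      have hv : Function.Injective v := e.injective.comp fun p q h =>
        huinj (congrArg Subtype.val h)
      exact hv.comp (MvPolynomial.mapEquiv (Fin n) κ.symm).injective
    simpa using WeylField.card_le_of_mvPolynomial φ hφ
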